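/- All graphs are finite, simple and undirected. A drawing of a graph $W$ in the plane represents the vertices by distinct points and every edge by a simple arc joining the points of its end vertices and containing no other vertex, such that any common point of two distinct edges that is not a vertex is a (transversal) crossing, and adjacent edges do not cross. The drawing is 1-planar if every edge is crossed at most once. The associated plane graph $D^\times$ of a 1-planar drawing $D$ is obtained by turning the crossings of $D$ into new vertices of degree four, called false vertices. The graph $W$ is of class $\mathcal C_0$ if it has a 1-planar drawing $D$ such that any two distinct false vertices of $D^\times$ have no common neighbour in $D^\times$. The join $G+H$ is obtained from vertex-disjoint copies of $G$ and $H$ by adding all edges between $V(G)$ and $V(H)$; $2P_1$ is the graph with two vertices and no edge, and $P_2$ is the path on two vertices. (1) If $G+2P_1$ is of class $\mathcal C_0$, then $|E(G)|\le |V(G)|+2$. This bound is tight: for every $k\ge 6$ there is a graph $G$ on $k$ vertices with $|E(G)|=k+2$ such that $G+2P_1$ is of class $\mathcal C_0$. (2) If $G+P_2$ is of class $\mathcal C_0$, then $|E(G)|\le |V(G)|+1$. This bound is tight: for every $k\ge 6$ there is a graph $G$ on $k$ vertices with $|E(G)|=k+1$ such that $G+P_2$ is of class $\mathcal C_0$.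 -/

import Mathlib

/-- The join `G + H`: disjoint copies of `G` and `H` together with all edges between them. -/
def SimpleGraph.joinProduct {V W : Type*} (G : SimpleGraph V) (H : SimpleGraph W) :
    SimpleGraph (V ⊕ W) :=
  (G ⊕g H) ⊔ completeBipartiteGraph V W

/-- `A` is a simple (Jordan) arc in the plane with end points `p` and `q`. -/
def IsSimpleArc (A : Set (ℝ × ℝ)) (p q : ℝ × ℝ) : Prop :=
  ∃ γ : C(unitInterval, ℝ × ℝ), Function.Injective γ ∧ γ 0 = p ∧ γ 1 = q ∧ Set.range γ = A

/-- `A` and `B` cross each other at `c`: in suitable local (topological) coordinates of the plane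
around `c`, the set `A` is the first coordinate axis and `B` is the second coordinate axis. -/
def CrossAt (A B : Set (ℝ × ℝ)) (c : ℝ × ℝ) : Prop :=
  ∃ φ : OpenPartialHomeomorph (ℝ × ℝ) (ℝ × ℝ), c ∈ φ.source ∧ φ c = (0, 0) ∧
    ∀ p ∈ φ.source, (p ∈ A ↔ (φ p).2 = 0) ∧ (p ∈ B ↔ (φ p).1 = 0)

/-- A drawing of a graph in the plane: vertices are distinct points, every edge is a simple arc
between its end vertices which contains no other vertex, any common point of two distinct edges
that is not a vertex is a crossing, and adjacent edges do not cross. -/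
structure PlaneDrawing {V : Type*} (W : SimpleGraph V) where
  /-- the position of a vertex -/
  point : V → ℝ × ℝ
  /-- the arc representing an edge -/
  arc : W.edgeSet → Set (ℝ × ℝ)
  point_injective : Function.Injective point
  isSimpleArc : ∀ (u v : V) (h : W.Adj u v),
    IsSimpleArc (arc ⟨s(u, v), h⟩) (point u) (point v)
  mem_of_point_mem_arc : ∀ (e : W.edgeSet) (v : V), point v ∈ arc e → v ∈ e.1
  crossAt : ∀ (e f : W.edgeSet) (p : ℝ × ℝ), e ≠ f → p ∈ arc e → p ∈ arc f →
    p ∉ Set.range point → CrossAt (arc e) (arc f) p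
  not_adjacent_of_cross : ∀ (e f : W.edgeSet) (p : ℝ × ℝ), e ≠ f → p ∈ arc e → p ∈ arc f →
    p ∉ Set.range point → ∀ v : V, ¬ (v ∈ e.1 ∧ v ∈ f.1)

namespace PlaneDrawing

variable {V : Type*} {W : SimpleGraph V}

/-- The distinct edges `e` and `f` cross each other at the point `p`. -/
def IsCrossing (D : PlaneDrawing W) (e f : W.edgeSet) (p : ℝ × ℝ) : Prop :=
  e ≠ f ∧ p ∈ D.arc e ∧ p ∈ D.arc f ∧ p ∉ Set.range D.point

/-- The crossings of a drawing, i.e. the false vertices of its associated plane graph. -/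
def falseVertices (D : PlaneDrawing W) : Set (ℝ × ℝ) :=
  {p | ∃ e f : W.edgeSet, D.IsCrossing e f p}

end PlaneDrawing

/-- A 1-planar drawing: every edge has at most one crossing (with at most one other edge). -/
structure OnePlanarDrawing {V : Type*} (W : SimpleGraph V) extends PlaneDrawing W where
  crossed_at_most_once : ∀ (e f f' : W.edgeSet) (p p' : ℝ × ℝ),
    toPlaneDrawing.IsCrossing e f p → toPlaneDrawing.IsCrossing e f' p' → f = f' ∧ p = p'

namespace OnePlanarDrawing

variable {V : Type*} {W : SimpleGraph V}

/-- The adjacency relation of the associated plane graph of a 1-planar drawing. Uncrossed edges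
are kept; an edge `uv` crossed at `c` is replaced by the two edges `uc` and `cv`. -/
def associatedAdj (D : OnePlanarDrawing W) :
    V ⊕ D.falseVertices → V ⊕ D.falseVertices → Prop
  | .inl u, .inl v => ∃ h : W.Adj u v, ∀ c ∈ D.falseVertices, c ∉ D.arc ⟨s(u, v), h⟩
  | .inl u, .inr c => ∃ e : W.edgeSet, u ∈ e.1 ∧ c.1 ∈ D.arc e
  | .inr c, .inl u => ∃ e : W.edgeSet, u ∈ e.1 ∧ c.1 ∈ D.arc e
  | .inr _, .inr _ => False

/-- The associated plane graph of a 1-planar drawing: crossings become new (false) vertices. -/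
def associatedGraph (D : OnePlanarDrawing W) : SimpleGraph (V ⊕ D.falseVertices) where
  Adj := D.associatedAdj
  symm := ⟨by
    rintro (u | c) (v | d) h
    · obtain ⟨h, hc⟩ := h
      refine ⟨h.symm, fun c hcf hca => hc c hcf ?_⟩
      have : (⟨s(v, u), h.symm⟩ : W.edgeSet) = ⟨s(u, v), h⟩ := Subtype.ext Sym2.eq_swap
      rwa [this] at hca
    · exact h
    · exact h
    · exact h⟩
  loopless := ⟨by
    rintro (u | c) h
    · exact W.loopless.irrefl u h.1
    · exact h⟩

/-- A `C₀`-drawing: no two false vertices of the associated plane graph have a common neighbour. -/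
def IsC0 (D : OnePlanarDrawing W) : Prop :=
  ∀ c₁ c₂ : D.falseVertices, c₁ ≠ c₂ →
    D.associatedGraph.neighborSet (.inr c₁) ∩ D.associatedGraph.neighborSet (.inr c₂) = ∅

end OnePlanarDrawing

/-- A graph is of class `C₀` if it has a 1-planar drawing that is a `C₀`-drawing. -/
def SimpleGraph.IsClassC0 {V : Type*} (W : SimpleGraph V) : Prop :=
  ∃ D : OnePlanarDrawing W, D.IsC0

/-! Upper bounds. Let `x`, `y` be the two vertices joined to `G` (the apices). In a C₀-drawing each
vertex is an end of the edges of at most one crossing (`IsC0.crosses_unique`). Two edges of `G`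
cannot cross: the apex edges at their ends would be uncrossed, and the crossing point, `x` and `y`
would form a plane K₃,₃ with three of these ends (`not_cross_of_common_neighbors`). So every
crossing has an apex among its ends, each apex lies in at most one crossing, and at most two edges
of `G` are crossed.

If no edge from `x` to `G` crosses an edge from `y` to `G`, the uncrossed edges of `G` form a graph
of maximum degree at most 2, since three such neighbours of `a` would form a plane K₃,₃ with `x`,
`y`, `a`. This gives |V| + 2. If `xa` crosses an edge from `y` to `G`, no edge of `G` is crossed,
and the same degree count, corrected at the neighbours of `a`, gives |V| + 1. Suppose now that `xy`
is an edge and no such pair crosses. If `xy` is crossed, at most one edge of `G` is crossed;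
otherwise a cycle of uncrossed edges would yield a subdivided plane K₅, so the uncrossed part is a
forest and |E(G)| ≤ (|V| - 1) + 2.

Nonplanarity is proved for arbitrary arcs without the Jordan curve theorem: disjoint paths satisfy
an integer relation between winding numbers, and for K₅ and K₃,₃ these relations are inconsistent
modulo 2.

Tightness. A cycle with the chords {0, 2} and {k-3, k-1} has an explicit straight-line drawing with
an apex on either side of a row of vertices. For `P₂` the row edge {2, 3} is deleted to make room
for `xy`. -/

/-! ### Winding numbers and the nonplanarity of K₅ and K₃,₃ -/

open Complex in
/-- A continuous nowhere vanishing function on the plane has a continuous logarithm. -/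
theorem exists_continuous_log (f : C(ℝ × ℝ, ℂ)) (hf : ∀ x, f x ≠ 0) :
    ∃ F : C(ℝ × ℝ, ℂ), ∀ x, exp (F x) = f x := by
  obtain ⟨F, ⟨-, hF⟩, -⟩ := isCoveringMapOn_exp.existsUnique_continuousMap_lifts f
    (a₀ := 0) (e₀ := log (f 0)) (exp_log (hf 0)) (fun a => hf a)
  exact ⟨F, fun x => congrFun hF x⟩

open Complex in
/-- Two continuous functions on the line with equal exponentials have equal increments. -/
theorem increment_eq_of_exp_eq {F G : ℝ → ℂ} (hF : Continuous F) (hG : Continuous G)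
    (h : ∀ t, exp (F t) = exp (G t)) : F 1 - F 0 = G 1 - G 0 := by
  have hc : Continuous fun t => F t - G t := hF.sub hG
  have hd : ∀ t, ∃ n : ℤ, F t - G t = n * (2 * Real.pi * I) := fun t => by
    obtain ⟨n, hn⟩ := exp_eq_exp_iff_exists_int.mp (h t)
    exact ⟨n, by rw [hn]; ring⟩
  choose n hn using hd
  have hpi : (2 * Real.pi : ℝ) ≠ 0 := by positivity
  have hcast : ∀ t, ((n t : ℤ) : ℝ) = (F t - G t).im / (2 * Real.pi) := fun t => by
    rw [hn t]
    have : ((n t : ℂ) * (2 * Real.pi * I)).im = (n t : ℝ) * (2 * Real.pi) := by simp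
    rw [this]; field_simp
  -- The difference of two logarithms, divided by `2πi`, is continuous and integer-valued, hence
  -- constant on the line.
  have hnc : Continuous n := by
    rw [Int.isClosedEmbedding_coe_real.isInducing.continuous_iff]
    have : (Int.cast ∘ n : ℝ → ℝ) = fun t => (F t - G t).im / (2 * Real.pi) := funext hcast
    rw [this]
    exact (continuous_im.comp hc).div_const _
  have h01 : n 1 = n 0 := PreconnectedSpace.constant inferInstance hnc
  have h1 := hn 1
  have h0 := hn 0
  rw [h01, ← h0] at h1
  linear_combination h1

open Complex in
/-- The total change of a logarithm of `γ - z` along a path `γ`. -/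
noncomputable def logIncrement {c d : ℂ} (z : ℂ) (γ : Path c d) : ℂ := by
  classical
  exact if h : ∃ F : ℝ → ℂ, Continuous F ∧ ∀ t, exp (F t) = γ.extend t - z then
    h.choose 1 - h.choose 0 else 0

open Complex in
theorem logIncrement_eq {c d z : ℂ} {γ : Path c d} {F : ℝ → ℂ} (hF : Continuous F)
    (h : ∀ t, exp (F t) = γ.extend t - z) : logIncrement z γ = F 1 - F 0 := by
  have hex : ∃ F : ℝ → ℂ, Continuous F ∧ ∀ t, exp (F t) = γ.extend t - z := ⟨F, hF, h⟩
  rw [logIncrement, dif_pos hex]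
  exact increment_eq_of_exp_eq hex.choose_spec.1 hF
    fun t => (hex.choose_spec.2 t).trans (h t).symm

theorem Path.extend_mem_range {X : Type*} [TopologicalSpace X] {a b : X} (γ : Path a b) (t : ℝ) :
    γ.extend t ∈ Set.range γ := by
  rw [← γ.extend_range]; exact ⟨t, rfl⟩

open Complex in
/-- The increments along the four sides of the parameter square of two disjoint paths cancel. -/
theorem logIncrement_relation {a b c d : ℂ} (α : Path a b) (β : Path c d)
    (h : Disjoint (Set.range α) (Set.range β)) :
    logIncrement a β - logIncrement b β = logIncrement c α - logIncrement d α := by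
  obtain ⟨F, hF⟩ := exists_continuous_log
    ⟨fun x : ℝ × ℝ => β.extend x.2 - α.extend x.1, by fun_prop⟩ (fun x hx =>
      Set.disjoint_left.mp h (α.extend_mem_range x.1)
        ((sub_eq_zero.mp hx) ▸ β.extend_mem_range x.2))
  simp only [ContinuousMap.coe_mk] at hF
  rw [logIncrement_eq (γ := β) (z := a) (F := fun t => F (0, t)) (by fun_prop)
      (fun t => by rw [hF]; simp),
    logIncrement_eq (γ := β) (z := b) (F := fun t => F (1, t)) (by fun_prop)
      (fun t => by rw [hF]; simp),
    -- `α(s) - c` is the negative of `β(0) - α(s)`; the shift of the logarithm by `πi` cancels in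
    -- the increment.
    logIncrement_eq (γ := α) (z := c) (F := fun s => F (s, 0) + Real.pi * I) (by fun_prop)
      (fun t => by rw [exp_add, hF, exp_pi_mul_I]; simp),
    logIncrement_eq (γ := α) (z := d) (F := fun s => F (s, 1) + Real.pi * I) (by fun_prop)
      (fun t => by rw [exp_add, hF, exp_pi_mul_I]; simp)]
  ring

-- This fixes the increment modulo `2πi` by its end points alone, so that only an integer depends on
-- the path.
open Complex in
theorem exp_logIncrement {c d z : ℂ} (γ : Path c d) (h : z ∉ Set.range γ) :
    exp (logIncrement z γ) * (c - z) = d - z := by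
  obtain ⟨F, hF⟩ := exists_continuous_log
    ⟨fun x : ℝ × ℝ => γ.extend x.2 - z, by fun_prop⟩ (fun x hx =>
      h ((sub_eq_zero.mp hx) ▸ γ.extend_mem_range x.2))
  simp only [ContinuousMap.coe_mk] at hF
  rw [logIncrement_eq (γ := γ) (z := z) (F := fun t => F (0, t)) (by fun_prop) (fun t => hF _),
    exp_sub, hF, hF]
  simp only [Path.extend_one, Path.extend_zero]
  have : c - z ≠ 0 := fun h0 => h ⟨0, by simp [sub_eq_zero.mp h0]⟩
  field_simp

open Complex in
/-- The integers measuring how paths wind around points satisfy, for any two disjoint paths, a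
relation whose inhomogeneous part records whether the four end points interleave. -/
theorem exists_winding_numbers {m : ℕ} (P : Fin m → ℂ) (hP : Function.Injective P)
    (γ : ∀ i j, Path (P i) (P j)) :
    ∃ N : Fin m → Fin m → Fin m → ℤ, ∀ a b c d,
      Disjoint (Set.range (γ a b)) (Set.range (γ c d)) →
      N a c d - N b c d - N c a b + N d a b =
        (if d < a then -1 else 0) + (if c < a then 1 else 0) + (if d < b then 1 else 0)
          + (if c < b then -1 else 0) := by
  classical
  -- A logarithm of `P v - P u` for each ordered pair. `L u v` and `L v u` differ by exactly `πi`,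
  -- with a sign given by the order of the indices; these half turns add up to the right-hand side
  -- of the relation, which is odd exactly if `{a, b}` and `{c, d}` interleave.
  let L : Fin m → Fin m → ℂ := fun u v =>
    if u < v then log (P v - P u) else log (P u - P v) + Real.pi * I
  have hL : ∀ u v, u ≠ v → exp (L u v) = P v - P u := by
    intro u v huv
    have h1 : P v - P u ≠ 0 := sub_ne_zero.mpr fun h => huv (hP h).symm
    have h2 : P u - P v ≠ 0 := sub_ne_zero.mpr fun h => huv (hP h)
    by_cases h : u < v
    · simp only [L, if_pos h, exp_log h1]
    · simp only [L, if_neg h, exp_add, exp_log h2, exp_pi_mul_I]; ring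
  have hLs : ∀ u v, u ≠ v → L u v - L v u = (2 * (if v < u then 1 else 0) - 1) * (Real.pi * I) := by
    intro u v huv
    rcases lt_or_gt_of_ne huv with h | h
    · simp only [L, if_pos h, if_neg h.not_gt]; ring
    · simp only [L, if_pos h, if_neg h.not_gt]; ring
  have hN : ∀ a c d, ∃ n : ℤ, P a ∉ Set.range (γ c d) →
      logIncrement (P a) (γ c d) = L a d - L a c + n * (2 * Real.pi * I) := by
    intro a c d
    by_cases h : P a ∈ Set.range (γ c d)
    · exact ⟨0, fun h' => absurd h h'⟩
    have hac : a ≠ c := by rintro rfl; exact h ⟨0, (γ _ _).source⟩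
    have had : a ≠ d := by rintro rfl; exact h ⟨1, (γ _ _).target⟩
    have h1 := exp_logIncrement (γ c d) h
    rw [← hL a c hac, ← hL a d had, ← exp_add] at h1
    obtain ⟨n, hn⟩ := exp_eq_exp_iff_exists_int.mp h1
    exact ⟨n, fun _ => by linear_combination hn⟩
  choose N hN using hN
  refine ⟨N, fun a b c d h => ?_⟩
  have ha : P a ∈ Set.range (γ a b) := ⟨0, (γ _ _).source⟩
  have hb : P b ∈ Set.range (γ a b) := ⟨1, (γ _ _).target⟩
  have hc : P c ∈ Set.range (γ c d) := ⟨0, (γ _ _).source⟩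
  have hd : P d ∈ Set.range (γ c d) := ⟨1, (γ _ _).target⟩
  have hac : a ≠ c := by rintro rfl; exact Set.disjoint_left.mp h ha hc
  have had : a ≠ d := by rintro rfl; exact Set.disjoint_left.mp h ha hd
  have hbc : b ≠ c := by rintro rfl; exact Set.disjoint_left.mp h hb hc
  have hbd : b ≠ d := by rintro rfl; exact Set.disjoint_left.mp h hb hd
  have hrel := logIncrement_relation (γ a b) (γ c d) h
  rw [hN a c d (Set.disjoint_left.mp h ha), hN b c d (Set.disjoint_left.mp h hb),
    hN c a b (Set.disjoint_right.mp h hc), hN d a b (Set.disjoint_right.mp h hd)] at hrel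
  have hpi : (2 * Real.pi * I : ℂ) ≠ 0 := two_pi_I_ne_zero
  have key : (2 * Real.pi * I : ℂ) * ((N a c d - N b c d - N c a b + N d a b : ℤ) : ℂ) =
      (2 * Real.pi * I) * (((if d < a then -1 else 0) + (if c < a then 1 else 0)
        + (if d < b then 1 else 0) + (if c < b then -1 else 0) : ℤ) : ℂ) := by
    push_cast
    have e1 : ∀ p : Prop, [Decidable p] → (if p then (-1 : ℂ) else 0) = -(if p then 1 else 0) := by
      intro p _; split_ifs <;> simp
    rw [e1, e1]
    linear_combination hrel - hLs a d had + hLs a c hac + hLs b d hbd - hLs b c hbc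
  exact_mod_cast mul_left_cancel₀ hpi key

/-- Sets joining pairs of points can be replaced by a full system of paths. -/
theorem exists_paths {m : ℕ} (p : Fin m → ℝ × ℝ) (S : Fin m → Fin m → Set (ℝ × ℝ))
    (E : Fin m → Fin m → Prop) (hS : ∀ i j, E i j → JoinedIn (S i j) (p i) (p j)) :
    ∃ γ : ∀ i j, Path (Complex.equivRealProdCLM.symm (p i)) (Complex.equivRealProdCLM.symm (p j)),
      ∀ i j, E i j → Set.range (γ i j) ⊆ Complex.equivRealProdCLM.symm '' S i j := by
  have : ∀ i j, ∃ γ : Path (Complex.equivRealProdCLM.symm (p i))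
      (Complex.equivRealProdCLM.symm (p j)),
      E i j → Set.range γ ⊆ Complex.equivRealProdCLM.symm '' S i j := by
    intro i j
    by_cases h : E i j
    · refine ⟨(hS i j h).somePath.map Complex.equivRealProdCLM.symm.continuous, fun _ => ?_⟩
      rintro _ ⟨t, rfl⟩
      exact ⟨_, (hS i j h).somePath_mem t, rfl⟩
    · exact ⟨PathConnectedSpace.somePath _ _, fun h' => absurd h' h⟩
  choose γ hγ using this
  exact ⟨γ, hγ⟩

/-- Winding numbers for a system of connecting sets, with the relation for disjoint ones. -/
theorem exists_winding_numbers_of_joinedIn {m : ℕ} (p : Fin m → ℝ × ℝ) (hp : Function.Injective p)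
    (S : Fin m → Fin m → Set (ℝ × ℝ)) (E : Fin m → Fin m → Prop)
    (hS : ∀ i j, E i j → JoinedIn (S i j) (p i) (p j)) :
    ∃ N : Fin m → Fin m → Fin m → ℤ, ∀ a b c d, E a b → E c d → Disjoint (S a b) (S c d) →
      N a c d - N b c d - N c a b + N d a b =
        (if d < a then -1 else 0) + (if c < a then 1 else 0) + (if d < b then 1 else 0)
          + (if c < b then -1 else 0) := by
  obtain ⟨γ, hγ⟩ := exists_paths p S E hS
  obtain ⟨N, hN⟩ := exists_winding_numbers _ (Complex.equivRealProdCLM.symm.injective.comp hp) γ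
  refine ⟨N, fun a b c d hab hcd h => hN a b c d ?_⟩
  exact Set.disjoint_of_subset (hγ a b hab) (hγ c d hcd)
    ((Set.disjoint_image_iff Complex.equivRealProdCLM.symm.injective).mpr h)

/-- The complete graph on five vertices is not planar, in a topological form. -/
theorem no_planar_K5 (p : Fin 5 → ℝ × ℝ) (hp : Function.Injective p)
    (S : Fin 5 → Fin 5 → Set (ℝ × ℝ)) (hS : ∀ i j, i < j → JoinedIn (S i j) (p i) (p j))
    (hd : ∀ i j k l, i < j → k < l → i < k → j ≠ k → j ≠ l → Disjoint (S i j) (S k l)) :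
    False := by
  obtain ⟨N, hN⟩ := exists_winding_numbers_of_joinedIn p hp S (· < ·) hS
  have H : ∀ a b c d : Fin 5, a < b → c < d → a < c → b ≠ c → b ≠ d → _ :=
    fun a b c d h1 h2 h3 h4 h5 => hN a b c d h1 h2 (hd a b c d h1 h2 h3 h4 h5)
  -- Modulo 2 the sum of the fifteen relations is contradictory: each `N v i j` occurs twice, once
  -- for each other end of an edge at `v` that avoids `i` and `j`, while five right-hand sides are
  -- odd, one for each set of four indices.
  have e1 := H 0 1 2 3 (by decide) (by decide) (by decide) (by decide) (by decide)
  have e2 := H 0 1 2 4 (by decide) (by decide) (by decide) (by decide) (by decide)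
  have e3 := H 0 1 3 4 (by decide) (by decide) (by decide) (by decide) (by decide)
  have e4 := H 0 2 1 3 (by decide) (by decide) (by decide) (by decide) (by decide)
  have e5 := H 0 2 1 4 (by decide) (by decide) (by decide) (by decide) (by decide)
  have e6 := H 0 2 3 4 (by decide) (by decide) (by decide) (by decide) (by decide)
  have e7 := H 0 3 1 2 (by decide) (by decide) (by decide) (by decide) (by decide)
  have e8 := H 0 3 1 4 (by decide) (by decide) (by decide) (by decide) (by decide)
  have e9 := H 0 3 2 4 (by decide) (by decide) (by decide) (by decide) (by decide)
  have e10 := H 0 4 1 2 (by decide) (by decide) (by decide) (by decide) (by decide)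
  have e11 := H 0 4 1 3 (by decide) (by decide) (by decide) (by decide) (by decide)
  have e12 := H 0 4 2 3 (by decide) (by decide) (by decide) (by decide) (by decide)
  have e13 := H 1 2 3 4 (by decide) (by decide) (by decide) (by decide) (by decide)
  have e14 := H 1 3 2 4 (by decide) (by decide) (by decide) (by decide) (by decide)
  have e15 := H 1 4 2 3 (by decide) (by decide) (by decide) (by decide) (by decide)
  simp at e1 e2 e3 e4 e5 e6 e7 e8 e9 e10 e11 e12 e13 e14 e15
  omega

/-- The complete bipartite graph with parts `{0, 1, 2}` and `{3, 4, 5}` is not planar, in a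
topological form. -/
theorem no_planar_K33 (p : Fin 6 → ℝ × ℝ) (hp : Function.Injective p)
    (S : Fin 6 → Fin 6 → Set (ℝ × ℝ))
    (hS : ∀ i j, i ≤ 2 → 3 ≤ j → JoinedIn (S i j) (p i) (p j))
    (hd : ∀ i j k l, i < k → k ≤ 2 → 3 ≤ j → 3 ≤ l → j ≠ l → Disjoint (S i j) (S k l)) :
    False := by
  obtain ⟨N, hN⟩ := exists_winding_numbers_of_joinedIn p hp S (fun i j => i ≤ 2 ∧ 3 ≤ j)
    (fun i j h => hS i j h.1 h.2)
  have H : ∀ a b c d : Fin 6, a < c ∧ c ≤ 2 ∧ 3 ≤ b ∧ 3 ≤ d ∧ b ≠ d → _ :=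
    fun a b c d h => hN a b c d ⟨h.1.le.trans h.2.1, h.2.2.1⟩ ⟨h.2.1, h.2.2.2.1⟩
      (hd a b c d h.1 h.2.1 h.2.2.1 h.2.2.2.1 h.2.2.2.2)
  -- Again each `N v i j` occurs twice. Here the edges `ij` and `kl` with `i < k` interleave exactly
  -- if `j < l`, which happens for 3 · 3 = 9 pairs, an odd number.
  have e1 := H 0 3 1 4 (by decide)
  have e2 := H 0 3 1 5 (by decide)
  have e3 := H 0 4 1 3 (by decide)
  have e4 := H 0 4 1 5 (by decide)
  have e5 := H 0 5 1 3 (by decide)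
  have e6 := H 0 5 1 4 (by decide)
  have e7 := H 0 3 2 4 (by decide)
  have e8 := H 0 3 2 5 (by decide)
  have e9 := H 0 4 2 3 (by decide)
  have e10 := H 0 4 2 5 (by decide)
  have e11 := H 0 5 2 3 (by decide)
  have e12 := H 0 5 2 4 (by decide)
  have e13 := H 1 3 2 4 (by decide)
  have e14 := H 1 3 2 5 (by decide)
  have e15 := H 1 4 2 3 (by decide)
  have e16 := H 1 4 2 5 (by decide)
  have e17 := H 1 5 2 3 (by decide)
  have e18 := H 1 5 2 4 (by decide)
  simp at e1 e2 e3 e4 e5 e6 e7 e8 e9 e10 e11 e12 e13 e14 e15 e16 e17 e18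
  omega

/-- The complete bipartite graph `K_{3,3}` is not planar, in a topological form. -/
theorem no_planar_K33_parts (p q : Fin 3 → ℝ × ℝ) (hp : Function.Injective p)
    (hq : Function.Injective q) (hpq : ∀ i j, p i ≠ q j) (S : Fin 3 → Fin 3 → Set (ℝ × ℝ))
    (hS : ∀ i j, JoinedIn (S i j) (p i) (q j))
    (hd : ∀ i j k l, i < k → j ≠ l → Disjoint (S i j) (S k l)) : False := by
  let r : Fin 6 → Fin 3 := fun k => ⟨k % 3, Nat.mod_lt _ (by norm_num)⟩
  refine no_planar_K33 (fun k => if k ≤ 2 then p (r k) else q (r k)) ?_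
    (fun i j => S (r i) (r j)) ?_ ?_
  · intro k l h
    have e1 : ∀ k l : Fin 6, k ≤ 2 → l ≤ 2 → r k = r l → k = l := by decide
    have e2 : ∀ k l : Fin 6, ¬ k ≤ 2 → ¬ l ≤ 2 → r k = r l → k = l := by decide
    dsimp only at h
    split_ifs at h with h1 h2 h2
    · exact e1 k l h1 h2 (hp h)
    · exact absurd h (hpq _ _)
    · exact absurd h.symm (hpq _ _)
    · exact e2 k l h1 h2 (hq h)
  · intro i j hi hj
    have : ¬ j ≤ 2 := by omega
    simpa only [if_pos hi, if_neg this] using hS (r i) (r j)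
  · have e : ∀ i j k l : Fin 6, i < k → k ≤ 2 → 3 ≤ j → 3 ≤ l → j ≠ l → r i < r k ∧ r j ≠ r l := by
      decide
    intro i j k l h1 h2 h3 h4 h5
    exact hd _ _ _ _ (e i j k l h1 h2 h3 h4 h5).1 (e i j k l h1 h2 h3 h4 h5).2

/-! ### Arcs, crossings and forbidden configurations in plane drawings -/

/-- A point of a simple arc other than its second end point is joined to the first end point inside
the arc without passing through the second end point. -/
theorem IsSimpleArc.exists_joinedIn {A : Set (ℝ × ℝ)} {p q c : ℝ × ℝ} (h : IsSimpleArc A p q)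
    (hc : c ∈ A) (hcq : c ≠ q) : ∃ S ⊆ A, q ∉ S ∧ JoinedIn S c p := by
  obtain ⟨γ, hinj, h0, h1, rfl⟩ := h
  obtain ⟨t, rfl⟩ := hc
  have ht : t ≠ 1 := by rintro rfl; exact hcq h1
  -- The part of the arc up to `c`; it misses `q` because the parametrization is injective.
  refine ⟨γ '' Set.Icc 0 t, Set.image_subset_range _ _, ?_, ?_⟩
  · rintro ⟨s, hs, hsq⟩
    rw [← h1] at hsq
    have : s = 1 := hinj hsq
    subst this
    exact ht (le_antisymm t.2.2 hs.2)
  · have hcomp : JoinedIn (Set.Icc (0 : unitInterval) t) t 0 := by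
      refine ⟨⟨⟨fun s => unitInterval.symm s * t, by fun_prop⟩, by simp, by simp⟩, fun s => ?_⟩
      exact ⟨unitInterval.nonneg', unitInterval.mul_le_right⟩
    simpa only [h0] using hcomp.map (f := γ) γ.continuous

theorem IsSimpleArc.joinedIn {A : Set (ℝ × ℝ)} {p q : ℝ × ℝ} (h : IsSimpleArc A p q) :
    JoinedIn A p q := by
  obtain ⟨γ, -, h0, h1, rfl⟩ := h
  exact ⟨⟨γ, h0, h1⟩, fun t => ⟨t, rfl⟩⟩

namespace PlaneDrawing

variable {V : Type*} {W : SimpleGraph V} (D : PlaneDrawing W)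

/-- The arc of an edge given as an unordered pair of vertices; it is empty for non-edges. -/
def curve (e : Sym2 V) : Set (ℝ × ℝ) := {p | ∃ h : e ∈ W.edgeSet, p ∈ D.arc ⟨e, h⟩}

/-- Two unordered pairs of vertices are edges which cross each other. -/
def Crosses (e f : Sym2 V) : Prop :=
  ∃ (he : e ∈ W.edgeSet) (hf : f ∈ W.edgeSet) (p : ℝ × ℝ), D.IsCrossing ⟨e, he⟩ ⟨f, hf⟩ p

variable {D}

theorem IsCrossing.symm {e f : W.edgeSet} {p : ℝ × ℝ} (h : D.IsCrossing e f p) :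
    D.IsCrossing f e p := ⟨h.1.symm, h.2.2.1, h.2.1, h.2.2.2⟩

theorem Crosses.symm {e f : Sym2 V} (h : D.Crosses e f) : D.Crosses f e := by
  obtain ⟨he, hf, p, hp⟩ := h
  exact ⟨hf, he, p, hp.symm⟩

theorem Crosses.not_mem_right {e f : Sym2 V} (h : D.Crosses e f) {v : V} (hv : v ∈ e) :
    v ∉ f := by
  obtain ⟨he, hf, p, h1, h2, h3, h4⟩ := h
  exact fun hv' => D.not_adjacent_of_cross _ _ p h1 h2 h3 h4 v ⟨hv, hv'⟩

theorem isSimpleArc_curve {u v : V} (h : W.Adj u v) :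
    IsSimpleArc (D.curve s(u, v)) (D.point u) (D.point v) := by
  have : D.curve s(u, v) = D.arc ⟨s(u, v), h⟩ := by
    ext p; exact ⟨fun ⟨_, hp⟩ => hp, fun hp => ⟨h, hp⟩⟩
  rw [this]
  exact D.isSimpleArc u v h

theorem joinedIn_curve {u v : V} (h : W.Adj u v) :
    JoinedIn (D.curve s(u, v)) (D.point u) (D.point v) := (isSimpleArc_curve h).joinedIn

theorem mem_of_point_mem_curve {e : Sym2 V} {v : V} (h : D.point v ∈ D.curve e) : v ∈ e := by
  obtain ⟨he, hp⟩ := h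
  exact D.mem_of_point_mem_arc _ v hp

theorem exists_common_vertex {e f : Sym2 V} {p : ℝ × ℝ} (hef : e ≠ f) (h : ¬ D.Crosses e f)
    (he : p ∈ D.curve e) (hf : p ∈ D.curve f) : ∃ v, v ∈ e ∧ v ∈ f ∧ D.point v = p := by
  by_contra! hv
  have hp : p ∉ Set.range D.point := by
    rintro ⟨v, rfl⟩
    exact hv v (mem_of_point_mem_curve he) (mem_of_point_mem_curve hf) rfl
  obtain ⟨he', hpe⟩ := he
  obtain ⟨hf', hpf⟩ := hf
  exact h ⟨he', hf', p, fun h' => hef (congrArg Subtype.val h'), hpe, hpf, hp⟩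

theorem disjoint_curve {a b c d : V} (h : ¬ D.Crosses s(a, b) s(c, d)) (hac : a ≠ c) (had : a ≠ d)
    (hbc : b ≠ c) (hbd : b ≠ d) : Disjoint (D.curve s(a, b)) (D.curve s(c, d)) := by
  rw [Set.disjoint_left]
  intro p h1 h2
  obtain ⟨v, hv1, hv2, -⟩ := exists_common_vertex (by simp [hac, had]) h h1 h2
  simp only [Sym2.mem_iff] at hv1 hv2
  rcases hv1 with rfl | rfl <;> rcases hv2 with rfl | rfl <;> simp_all

variable (D)

/-- A drawing contains no copy of `K_{3,3}` whose independent edges do not cross. -/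
theorem not_K33 (f g : Fin 3 → V) (hf : Function.Injective f) (hg : Function.Injective g)
    (hfg : ∀ i j, f i ≠ g j) (hadj : ∀ i j, W.Adj (f i) (g j))
    (hc : ∀ i j k l, i < k → j ≠ l → ¬ D.Crosses s(f i, g j) s(f k, g l)) : False := by
  refine no_planar_K33_parts (D.point ∘ f) (D.point ∘ g) (D.point_injective.comp hf)
    (D.point_injective.comp hg) (fun i j h => hfg i j (D.point_injective h))
    (fun i j => D.curve s(f i, g j)) (fun i j => joinedIn_curve (hadj i j)) ?_
  intro i j k l hik hjl
  exact disjoint_curve (hc i j k l hik hjl) (hf.ne hik.ne) (hfg _ _) (hfg _ _).symm (hg.ne hjl)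

/-- Two crossing edges do not have three end points with two further common neighbours, if the
edges to these neighbours are not crossed. -/
theorem not_cross_of_common_neighbors {x y a b c d : V} (hxy : x ≠ y)
    (hx : x ∉ s(a, b) ∧ x ∉ s(c, d)) (hy : y ∉ s(a, b) ∧ y ∉ s(c, d))
    (hadjx : W.Adj x a ∧ W.Adj x b ∧ W.Adj x c) (hadjy : W.Adj y a ∧ W.Adj y b ∧ W.Adj y c)
    (hnc : ∀ z v e, (z = x ∨ z = y) → (v = a ∨ v = b ∨ v = c) → ¬ D.Crosses s(z, v) e) :
    ¬ D.Crosses s(a, b) s(c, d) := by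
  intro hcr
  have ha := hcr.not_mem_right (v := a) (by simp)
  have hb := hcr.not_mem_right (v := b) (by simp)
  obtain ⟨he, hf, p, hpc⟩ := hcr
  have hpt : ∀ v, p ≠ D.point v := fun v h => hpc.2.2.2 ⟨v, h.symm⟩
  have hpe : p ∈ D.curve s(a, b) := ⟨he, hpc.2.1⟩
  have hpf : p ∈ D.curve s(c, d) := ⟨hf, hpc.2.2.1⟩
  have hab : W.Adj a b := he
  have hcd : W.Adj c d := hf
  obtain ⟨Sa, hSa, hbSa, hja⟩ := (isSimpleArc_curve hab).exists_joinedIn hpe (hpt b)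
  obtain ⟨Sb, hSb, haSb, hjb⟩ := (isSimpleArc_curve (D := D) hab.symm).exists_joinedIn
    (by rwa [Sym2.eq_swap]) (hpt a)
  obtain ⟨Sc, hSc, -, hjc⟩ := (isSimpleArc_curve hcd).exists_joinedIn hpf (hpt d)
  rw [Sym2.eq_swap] at hSb
  simp only [Sym2.mem_iff, not_or] at hx hy ha hb
  let v : Fin 3 → V := ![a, b, c]
  let T : Fin 3 → Set (ℝ × ℝ) := ![Sa, Sb, Sc]
  let z : Fin 3 → V := ![x, y, y]
  have hvT : ∀ j l, j ≠ l → D.point (v j) ∉ T l := by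
    have hav : D.point a ∉ Sc := fun h => by
      have := mem_of_point_mem_curve (hSc h); simp [ha] at this
    have hbv : D.point b ∉ Sc := fun h => by
      have := mem_of_point_mem_curve (hSc h); simp [hb] at this
    have hca : D.point c ∉ Sa := fun h => by
      have := mem_of_point_mem_curve (hSa h); simp [ha.1, hb.1, eq_comm] at this
    have hcb : D.point c ∉ Sb := fun h => by
      have := mem_of_point_mem_curve (hSb h); simp [ha.1, hb.1, eq_comm] at this
    intro j l hjl
    fin_cases j <;> fin_cases l <;> first | exact absurd rfl hjl | assumption
  have hTsub : ∀ l, T l ⊆ D.curve s(a, b) ∨ T l ⊆ D.curve s(c, d) := by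
    intro l
    fin_cases l
    exacts [Or.inl hSa, Or.inl hSb, Or.inr hSc]
  have hv : ∀ j, v j = a ∨ v j = b ∨ v j = c := by intro j; fin_cases j <;> simp [v]
  have hvinj : Function.Injective v := by
    intro i j h
    have hab' := hab.ne
    fin_cases i <;> fin_cases j <;> simp_all [v, eq_comm]
  have hzv : ∀ i j, (z i = x ∨ z i = y) ∧ z i ≠ v j := by
    intro i j
    fin_cases i <;> fin_cases j <;> simp_all [v, z]
  have hzdisj : ∀ i j l, j ≠ l → Disjoint (D.curve s(z i, v j)) (T l) := by
    intro i j l hjl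
    rw [Set.disjoint_left]
    intro q hq1 hq2
    have key : ∀ e, z i ∉ e → q ∈ D.curve e → False := by
      intro e hze hqe
      obtain ⟨w, hw1, hw2, rfl⟩ := exists_common_vertex (by rintro rfl; simp at hze)
        (hnc _ _ _ (hzv i j).1 (hv j)) hq1 hqe
      rcases Sym2.mem_iff.mp hw1 with rfl | rfl
      · exact hze hw2
      · exact hvT j l hjl hq2
    have hze : z i ∉ s(a, b) ∧ z i ∉ s(c, d) := by
      rcases (hzv i j).1 with h | h <;> rw [h] <;> simp [hx, hy]
    rcases hTsub l with h | h
    · exact key _ hze.1 (h hq2)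
    · exact key _ hze.2 (h hq2)
  refine no_planar_K33_parts ![D.point x, D.point y, p] (D.point ∘ v) ?_
    (D.point_injective.comp hvinj) ?_
    ![fun j => D.curve s(x, v j), fun j => D.curve s(y, v j), T] ?_ ?_
  · have h1 : D.point x ≠ D.point y := D.point_injective.ne hxy
    have h2 := hpt x
    have h3 := hpt y
    intro i j h
    fin_cases i <;> fin_cases j <;> simp_all [eq_comm]
  · intro i j
    fin_cases i
    · exact D.point_injective.ne (hzv 0 j).2
    · exact D.point_injective.ne (hzv 1 j).2
    · exact hpt _
  · intro i j
    fin_cases i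
    · refine joinedIn_curve ?_
      rcases hv j with h | h | h <;> rw [h] <;> simp [hadjx]
    · refine joinedIn_curve ?_
      rcases hv j with h | h | h <;> rw [h] <;> simp [hadjy]
    · fin_cases j
      exacts [hja, hjb, hjc]
  · intro i j k l hik hjl
    fin_cases i <;> fin_cases k <;> first | exact absurd hik (by decide) | skip
    · exact disjoint_curve (hnc _ _ _ (Or.inl rfl) (hv j)) hxy (hzv 0 l).2 (hzv 1 j).2.symm
        (hvinj.ne hjl)
    · exact hzdisj 0 j l hjl
    · exact hzdisj 1 j l hjl

end PlaneDrawing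

/-! ### Crossings in C₀-drawings and the bound for 2P₁ -/

namespace OnePlanarDrawing

open PlaneDrawing

variable {V : Type*} {W : SimpleGraph V} {D : OnePlanarDrawing W}

/-- In a `C₀`-drawing a vertex is an end of the edges of at most one crossing. -/
theorem IsC0.crosses_unique (hD : D.IsC0) {e f e' f' : Sym2 V} (h : D.Crosses e f)
    (h' : D.Crosses e' f') {v : V} (hv : v ∈ e ∨ v ∈ f) (hv' : v ∈ e' ∨ v ∈ f') :
    (e' = e ∧ f' = f) ∨ (e' = f ∧ f' = e) := by
  obtain ⟨he, hf, p, hp⟩ := h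
  obtain ⟨he', hf', p', hp'⟩ := h'
  have hadj : ∀ {e f : W.edgeSet} {q : ℝ × ℝ} (hq : D.IsCrossing e f q), (v ∈ e.1 ∨ v ∈ f.1) →
      (.inl v) ∈ D.associatedGraph.neighborSet (.inr ⟨q, e, f, hq⟩) := by
    rintro e f q hq (hv | hv)
    · exact ⟨e, hv, hq.2.1⟩
    · exact ⟨f, hv, hq.2.2.1⟩
  -- `v` is a neighbour of both false vertices, so these coincide; 1-planarity then identifies the
  -- edges through the point.
  have hpp : p = p' := by
    by_contra hne
    have hempty := hD ⟨p, _, _, hp⟩ ⟨p', _, _, hp'⟩ (fun h => hne (congrArg Subtype.val h))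
    have hmem : (.inl v : V ⊕ D.falseVertices) ∈ (∅ : Set (V ⊕ D.falseVertices)) := by
      rw [← hempty]
      exact ⟨hadj hp hv, hadj hp' hv'⟩
    exact hmem
  subst hpp
  by_cases h1 : e' = e
  · subst h1
    exact Or.inl ⟨rfl, congrArg Subtype.val (D.crossed_at_most_once _ _ _ p p hp' hp).1⟩
  · have h2 : D.IsCrossing ⟨e, he⟩ ⟨e', he'⟩ p :=
      ⟨fun h => h1 (congrArg Subtype.val h).symm, hp.2.1, hp'.2.1, hp.2.2.2⟩
    exact Or.inr ⟨congrArg Subtype.val (D.crossed_at_most_once _ _ _ p p h2 hp).1,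
      congrArg Subtype.val (D.crossed_at_most_once _ _ _ p p hp' h2.symm).1⟩

end OnePlanarDrawing

namespace SimpleGraph

variable {V W : Type*} {G : SimpleGraph V} {H : SimpleGraph W}

@[simp] theorem joinProduct_adj_inl_inl {a b : V} :
    (G.joinProduct H).Adj (.inl a) (.inl b) ↔ G.Adj a b := by
  simp [joinProduct]

@[simp] theorem joinProduct_adj_inr_inr {a b : W} :
    (G.joinProduct H).Adj (.inr a) (.inr b) ↔ H.Adj a b := by
  simp [joinProduct]

@[simp] theorem joinProduct_adj_inl_inr {a : V} {b : W} :
    (G.joinProduct H).Adj (.inl a) (.inr b) := by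
  simp [joinProduct]

@[simp] theorem joinProduct_adj_inr_inl {a : V} {b : W} :
    (G.joinProduct H).Adj (.inr b) (.inl a) := by
  simp [joinProduct]

/-- A forest extends to a spanning tree of the complete graph on `V`. -/
theorem IsAcyclic.ncard_edgeSet_add_one_le [Fintype V] [Nonempty V] (h : G.IsAcyclic) :
    G.edgeSet.ncard + 1 ≤ Fintype.card V := by
  classical
  obtain ⟨T, hGT, -, hT⟩ := (connected_top (V := V)).exists_isTree_le_of_le_of_isAcyclic le_top h
  have h1 := hT.card_edgeFinset
  rw [← h1, ← coe_edgeFinset, Set.ncard_coe_finset]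
  exact Nat.add_le_add_right (Finset.card_le_card (edgeFinset_mono hGT)) 1

theorem two_mul_ncard_edgeSet [Fintype V] [DecidableRel G.Adj] :
    2 * G.edgeSet.ncard = ∑ v, G.degree v := by
  classical
  rw [sum_degrees_eq_twice_card_edges, ← coe_edgeFinset, Set.ncard_coe_finset]

end SimpleGraph

namespace OnePlanarDrawing

open PlaneDrawing

variable {V : Type*} {G : SimpleGraph V} {H : SimpleGraph (Fin 2)}
  {D : OnePlanarDrawing (G.joinProduct H)}

/-- In a `C₀`-drawing of a join with a graph on two vertices, every crossing involves an edge at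
one of these two vertices. -/
theorem IsC0.exists_apex_of_crosses (hD : D.IsC0) {e f : Sym2 (V ⊕ Fin 2)} (h : D.Crosses e f) :
    ∃ i : Fin 2, .inr i ∈ e ∨ .inr i ∈ f := by
  by_contra! hcon
  induction e using Sym2.ind with | _ a b
  induction f using Sym2.ind with | _ c d
  have key : ∀ w : V ⊕ Fin 2, (∀ i : Fin 2, .inr i ≠ w) → ∃ v, w = .inl v := by
    rintro (v | i) hw
    · exact ⟨v, rfl⟩
    · exact absurd rfl (hw i)
  simp only [Sym2.mem_iff, not_or] at hcon
  obtain ⟨a, rfl⟩ := key a fun i => (hcon i).1.1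
  obtain ⟨b, rfl⟩ := key b fun i => (hcon i).1.2
  obtain ⟨c, rfl⟩ := key c fun i => (hcon i).2.1
  obtain ⟨d, rfl⟩ := key d fun i => (hcon i).2.2
  refine D.not_cross_of_common_neighbors (x := .inr 0) (y := .inr 1) (by simp) (by simp) (by simp)
    (by simp) (by simp) ?_ h
  intro z v e hz hv hze
  have hvm : v ∈ s(Sum.inl a, Sum.inl b) ∨ v ∈ s(Sum.inl c, Sum.inl d) := by
    rcases hv with rfl | rfl | rfl <;> simp
  -- A crossing on the apex edge `zv` would share the end `v` with the given crossing and hence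
  -- equal it, but the latter has no apex among its ends.
  rcases hD.crosses_unique h hze hvm (Or.inl (by simp)) with ⟨h1, -⟩ | ⟨h1, -⟩ <;>
  rcases hz with rfl | rfl <;> simp at h1

variable (D) in
/-- The edges of `G` which are not crossed in a drawing of a join of `G`. -/
def uncrossedPart : SimpleGraph V where
  Adj a b := G.Adj a b ∧ ∀ e, ¬ D.Crosses s(.inl a, .inl b) e
  symm := ⟨fun a b h => ⟨h.1.symm, by simpa only [Sym2.eq_swap] using h.2⟩⟩
  loopless := ⟨fun _ h => h.1.ne rfl⟩

variable (D) in
/-- A vertex does not have three neighbours by uncrossed edges of `G`, unless the edges from these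
to the two apices cross. -/
theorem card_le_two_of_uncrossed (a : V) (s : Finset V)
    (hs : ∀ u ∈ s, D.uncrossedPart.Adj a u)
    (hc : ∀ u ∈ s, ∀ v ∈ s, ¬ D.Crosses s(.inr 0, .inl u) s(.inr 1, .inl v)) : s.card ≤ 2 := by
  by_contra! hcard
  obtain ⟨b, hb, c, hc', d, hd, hbc, hbd, hcd⟩ := Finset.two_lt_card.mp hcard
  have ht : ∀ j, (![b, c, d] : Fin 3 → V) j ∈ s := by
    intro j; fin_cases j <;> assumption
  refine D.not_K33 ![.inr 0, .inr 1, .inl a] (Sum.inl ∘ ![b, c, d]) ?_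
    (Sum.inl_injective.comp ?_) ?_ ?_ ?_
  · intro i j h
    fin_cases i <;> fin_cases j <;> simp_all
  · intro i j h
    fin_cases i <;> fin_cases j <;> simp_all [eq_comm]
  · intro i j
    have := (hs _ (ht j)).1.ne
    fin_cases i
    · simp
    · simp
    · simpa using this
  · intro i j
    have := (hs _ (ht j)).1
    fin_cases i
    · simp
    · simp
    · simpa using this
  · intro i j k l hik hjl
    fin_cases i <;> fin_cases k <;> first | exact absurd hik (by decide) | skip
    · exact hc _ (ht j) _ (ht l)
    · exact fun h => (hs _ (ht l)).2 _ h.symm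
    · exact fun h => (hs _ (ht l)).2 _ h.symm

variable (D) in
/-- The edges of `G` which are crossed by an edge at the apex `i`. -/
def crossedAt (i : Fin 2) : Set (Sym2 V) :=
  {e | ∃ f, D.Crosses (e.map .inl) f ∧ .inr i ∈ f}

theorem inr_notMem_map_inl {α β : Type*} (e : Sym2 α) (i : β) : Sum.inr i ∉ e.map Sum.inl := by
  simp [Sym2.mem_map]

/-- The apex is an end of at most one crossing, and of its two edges only the one without an apex
can come from `G`. -/
theorem IsC0.crossedAt_subsingleton (hD : D.IsC0) (i : Fin 2) :
    (D.crossedAt i).Subsingleton := by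
  rintro e ⟨f, hf, hif⟩ e' ⟨f', hf', hif'⟩
  rcases hD.crosses_unique hf hf' (Or.inr hif) (Or.inr hif') with ⟨h, -⟩ | ⟨h, -⟩
  · exact (Sym2.map.injective Sum.inl_injective h).symm
  · exact absurd (h ▸ hif) (inr_notMem_map_inl e' i)

theorem IsC0.edgeSet_subset (hD : D.IsC0) :
    G.edgeSet ⊆ D.uncrossedPart.edgeSet ∪ (D.crossedAt 0 ∪ D.crossedAt 1) := by
  intro e he
  induction e using Sym2.ind with | _ a b
  by_cases h : ∃ f, D.Crosses s(.inl a, .inl b) f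
  · right
    obtain ⟨f, hf⟩ := h
    obtain ⟨i, hi⟩ := hD.exists_apex_of_crosses hf
    replace hi : .inr i ∈ f := by simpa using hi
    have hm : s(a, b) ∈ D.crossedAt i := ⟨f, by simpa using hf, hi⟩
    fin_cases i
    exacts [Or.inl hm, Or.inr hm]
  · exact Or.inl ⟨he, not_exists.mp h⟩

variable [Fintype V]

/-- The bound when an edge at one apex crosses an edge at the other apex. -/
theorem IsC0.ncard_edgeSet_le_of_apices_cross (hD : D.IsC0) {a b : V}
    (h : D.Crosses s(.inr 0, .inl a) s(.inr 1, .inl b)) :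
    G.edgeSet.ncard ≤ Fintype.card V + 1 := by
  classical
  -- Every crossing has an apex end and is therefore the given one, both of whose edges are apex
  -- edges.
  have hG : ∀ u v, G.Adj u v → D.uncrossedPart.Adj u v := by
    refine fun u v huv => ⟨huv, fun e he => ?_⟩
    obtain ⟨i, hi⟩ := hD.exists_apex_of_crosses he
    have hi' : (.inr i : V ⊕ Fin 2) ∈ s((.inr 0 : V ⊕ Fin 2), .inl a) ∨
        (.inr i : V ⊕ Fin 2) ∈ s((.inr 1 : V ⊕ Fin 2), .inl b) := by
      fin_cases i <;> simp
    rcases hD.crosses_unique h he hi' hi with ⟨h1, -⟩ | ⟨h1, -⟩ <;> simp at h1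
  have hX : ∀ u v, D.Crosses s(.inr 0, .inl u) s(.inr 1, .inl v) → u = a ∧ v = b := by
    intro u v huv
    rcases hD.crosses_unique h huv (v := .inr 0) (by simp) (by simp) with ⟨h1, h2⟩ | ⟨h1, -⟩
    · simpa using And.intro h1 h2
    · simp at h1
  -- The only crossing between edges at different apices uses `a`, so the K₃,₃ argument applies to
  -- the neighbours other than `a`.
  have hdeg : ∀ w, G.degree w ≤ 2 + if w ∈ G.neighborFinset a then 1 else 0 := by
    intro w
    have h1 : ((G.neighborFinset w).erase a).card ≤ 2 := by
      refine D.card_le_two_of_uncrossed w _ (fun u hu => hG _ _ ?_) fun u hu v _ huv => ?_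
      · simpa using Finset.mem_of_mem_erase hu
      · exact Finset.ne_of_mem_erase hu (hX u v huv).1
    rw [← G.card_neighborFinset_eq_degree]
    split_ifs with hw
    · have := Finset.pred_card_le_card_erase (s := G.neighborFinset w) (a := a)
      omega
    · rwa [Finset.erase_eq_of_notMem] at h1
      simpa [G.adj_comm] using hw
  have hdega : G.degree a ≤ 2 := by
    have := hdeg a
    simpa using this
  -- Thus `2|E| ≤ 2|V| + deg a ≤ 2|V| + 2`.
  have hsum : ∑ v, G.degree v ≤ ∑ w, (2 + if w ∈ G.neighborFinset a then 1 else 0) :=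
    Finset.sum_le_sum fun w _ => hdeg w
  rw [← SimpleGraph.two_mul_ncard_edgeSet, Finset.sum_add_distrib, Finset.sum_const,
    Finset.sum_ite_mem, Finset.univ_inter, Finset.sum_const, G.card_neighborFinset_eq_degree,
    Finset.card_univ, smul_eq_mul, smul_eq_mul] at hsum
  omega

variable (D) in
theorem ncard_uncrossedPart_le
    (h : ∀ u v, ¬ D.Crosses s(.inr 0, .inl u) s(.inr 1, .inl v)) :
    D.uncrossedPart.edgeSet.ncard ≤ Fintype.card V := by
  classical
  have hsum : ∑ v, D.uncrossedPart.degree v ≤ ∑ _w : V, 2 := Finset.sum_le_sum fun w _ => by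
    rw [← SimpleGraph.card_neighborFinset_eq_degree]
    exact D.card_le_two_of_uncrossed w _ (fun u hu => by simpa using hu) fun u _ v _ => h u v
  rw [← SimpleGraph.two_mul_ncard_edgeSet, Finset.sum_const, Finset.card_univ, smul_eq_mul] at hsum
  omega

theorem IsC0.ncard_edgeSet_le_add (hD : D.IsC0) :
    G.edgeSet.ncard ≤ D.uncrossedPart.edgeSet.ncard + (D.crossedAt 0 ∪ D.crossedAt 1).ncard :=
  (Set.ncard_le_ncard hD.edgeSet_subset (Set.toFinite _)).trans (Set.ncard_union_le _ _)

theorem IsC0.ncard_crossed_le_two (hD : D.IsC0) :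
    (D.crossedAt 0 ∪ D.crossedAt 1).ncard ≤ 2 := by
  have h := Set.ncard_union_le (D.crossedAt 0) (D.crossedAt 1)
  have h0 := Set.ncard_le_one_iff_subsingleton.mpr (hD.crossedAt_subsingleton 0)
  have h1 := Set.ncard_le_one_iff_subsingleton.mpr (hD.crossedAt_subsingleton 1)
  omega

theorem IsC0.ncard_edgeSet_le_card_add_two (hD : D.IsC0) :
    G.edgeSet.ncard ≤ Fintype.card V + 2 := by
  by_cases h : ∃ a b, D.Crosses s(.inr 0, .inl a) s(.inr 1, .inl b)
  · obtain ⟨a, b, h⟩ := h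
    have := hD.ncard_edgeSet_le_of_apices_cross h
    omega
  · push Not at h
    have h1 := D.ncard_uncrossedPart_le h
    have h2 := hD.ncard_edgeSet_le_add
    have h3 := hD.ncard_crossed_le_two
    omega

end OnePlanarDrawing

/-! ### The bound for P₂ -/

namespace OnePlanarDrawing

open PlaneDrawing

variable {V : Type*} {G : SimpleGraph V} {H : SimpleGraph (Fin 2)}
  (D : OnePlanarDrawing (G.joinProduct H))

/-- The part of a drawing formed by the vertices of `G` other than `v` and by the uncrossed edges
between them. -/
def regionAvoiding (v : V) : Set (ℝ × ℝ) :=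
  {q | (∃ a, a ≠ v ∧ q = D.point (.inl a)) ∨
    ∃ a b, a ≠ v ∧ b ≠ v ∧ D.uncrossedPart.Adj a b ∧ q ∈ D.curve s(.inl a, .inl b)}

theorem joinedIn_regionAvoiding {v a b : V} (p : D.uncrossedPart.Walk a b)
    (hv : v ∉ p.support) : JoinedIn (D.regionAvoiding v) (D.point (.inl a)) (D.point (.inl b)) := by
  induction p with
  | nil => exact JoinedIn.refl (Or.inl ⟨_, by simpa [eq_comm] using hv, rfl⟩)
  | @cons a b c h p ih =>
    simp only [SimpleGraph.Walk.support_cons, List.mem_cons, not_or] at hv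
    have hb : b ≠ v := fun h => hv.2 (h ▸ p.start_mem_support)
    refine JoinedIn.trans ((joinedIn_curve (D := D.toPlaneDrawing) ?_).mono ?_) (ih hv.2)
    · simpa using h.1
    · exact fun q hq => Or.inr ⟨a, b, Ne.symm hv.1, hb, h, hq⟩

theorem disjoint_regionAvoiding {v : V} {e : Sym2 (V ⊕ Fin 2)}
    (he : ∀ a, .inl a ∈ e → a = v) : Disjoint (D.curve e) (D.regionAvoiding v) := by
  rw [Set.disjoint_left]
  rintro q hq (⟨a, ha, rfl⟩ | ⟨a, b, ha, hb, hab, hq'⟩)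
  · exact ha (he a (mem_of_point_mem_curve hq))
  · have hne : s(.inl a, .inl b) ≠ e := by
      rintro rfl
      exact ha (he a (by simp))
    obtain ⟨w, hw, hwe, -⟩ := exists_common_vertex hne (hab.2 e) hq' hq
    rcases Sym2.mem_iff.mp hw with rfl | rfl
    · exact ha (he _ hwe)
    · exact hb (he _ hwe)

variable {D}

/-- If the two apices are joined by an uncrossed edge and their edges do not cross each other, the
uncrossed edges of `G` form a forest. -/
theorem isAcyclic_uncrossedPart (hH : H.Adj 0 1)
    (hxy : ∀ e, ¬ D.Crosses s(.inr 0, .inr 1) e)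
    (hc : ∀ u v, ¬ D.Crosses s(.inr 0, .inl u) s(.inr 1, .inl v)) :
    D.uncrossedPart.IsAcyclic := by
  have := Classical.decEq V
  rw [SimpleGraph.isAcyclic_iff_forall_adj_isBridge]
  intro v u hvu
  rw [SimpleGraph.isBridge_iff]
  rintro ⟨p⟩
  obtain ⟨p, hp⟩ := p.toPath
  -- A path from `v` to `u` avoiding the edge `vu` starts with some `w ≠ u`, and its remainder
  -- avoids `v`.
  cases p with
  | nil => exact hvu.ne rfl
  | @cons _ w _ hvw p =>
    rw [SimpleGraph.Walk.cons_isPath_iff] at hp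
    rw [SimpleGraph.deleteEdges_adj] at hvw
    have hwu : w ≠ u := by rintro rfl; exact hvw.2 rfl
    have hT := D.joinedIn_regionAvoiding (v := v)
      (p.mapLe (SimpleGraph.deleteEdges_le _)) (by simpa using hp.2)
    have hwv : w ≠ v := hvw.1.ne.symm
    have huv : u ≠ v := hvu.ne.symm
    -- Branch vertices of a K₅ in which the pair `wu` (indices 2 and 4) is joined inside
    -- `regionAvoiding v`. The edges independent of `wu` are those among the two apices and `v`;
    -- they meet `V` at most in `v`, so the whole region can be used in place of the path.
    let z : Fin 5 → V ⊕ Fin 2 := ![.inr 0, .inr 1, .inl w, .inl v, .inl u]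
    have hz : Function.Injective z := by
      intro i j h
      fin_cases i <;> fin_cases j <;> simp_all [z, eq_comm]
    have hadj : ∀ i j, i < j → ¬ (i = 2 ∧ j = 4) → (G.joinProduct H).Adj (z i) (z j) := by
      have h1 := hvw.1.1
      have h2 := hvu.1
      intro i j hij hne
      fin_cases i <;> fin_cases j <;>
        first | exact absurd hij (by decide) | simp_all [z, G.adj_comm]
    have hcases : ∀ i j k l : Fin 5, i < j → k < l → i < k → j ≠ k → j ≠ l →
        ¬ (i = 2 ∧ j = 4) ∧ ((i = 0 ∧ j = 1 ∧ ¬ (k = 2 ∧ l = 4)) ∨ (k = 2 ∧ l = 3) ∨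
          (k = 3 ∧ l = 4) ∨ (k = 2 ∧ l = 4 ∧ i ≤ 1 ∧ (j = 1 ∨ j = 3)) ∨
          (i = 0 ∧ k = 1 ∧ 2 ≤ j ∧ 2 ≤ l)) := by
      omega
    have hspoke : ∀ j : Fin 5, 2 ≤ j → ∃ t, z j = .inl t := by
      intro j hj
      fin_cases j <;> first | exact absurd hj (by decide) | exact ⟨_, rfl⟩
    refine no_planar_K5 (D.point ∘ z) (D.point_injective.comp hz)
      (fun i j => if i = 2 ∧ j = 4 then D.regionAvoiding v else D.curve s(z i, z j)) ?_ ?_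
    · intro i j hij
      split_ifs with h
      · obtain ⟨rfl, rfl⟩ := h
        exact hT
      · exact joinedIn_curve (hadj i j hij h)
    · intro i j k l hij hkl hik hjk hjl
      obtain ⟨h1, h2⟩ := hcases i j k l hij hkl hik hjk hjl
      rw [if_neg h1]
      have hdis : ¬ D.Crosses s(z i, z j) s(z k, z l) →
          Disjoint (D.curve s(z i, z j)) (D.curve s(z k, z l)) := fun h =>
        disjoint_curve h (hz.ne hik.ne) (hz.ne (hik.trans hkl).ne) (hz.ne hjk) (hz.ne hjl)
      rcases h2 with ⟨rfl, rfl, h⟩ | ⟨rfl, rfl⟩ | ⟨rfl, rfl⟩ | ⟨rfl, rfl, hi, hj⟩ | ⟨rfl, rfl, h, h'⟩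
      · rw [if_neg h]
        exact hdis (hxy _)
      · exact hdis fun h => hvw.1.symm.2 _ h.symm
      · exact hdis fun h => hvu.2 _ h.symm
      · refine D.disjoint_regionAvoiding fun a ha => ?_
        have hi' : i = 0 ∨ i = 1 := by omega
        rcases hi' with rfl | rfl <;> rcases hj with rfl | rfl <;> simp [z] at ha <;> exact ha
      · have : ¬ ((1 : Fin 5) = 2 ∧ l = 4) := by simp
        rw [if_neg this]
        obtain ⟨s, hs⟩ := hspoke j h
        obtain ⟨t, ht⟩ := hspoke l h'
        refine hdis ?_
        rw [hs, ht]
        exact hc s t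

/-- If the edge between the apices is crossed, at most one edge of `G` is crossed. -/
theorem IsC0.ncard_crossed_le_one (hD : D.IsC0) {e : Sym2 (V ⊕ Fin 2)}
    (h : D.Crosses s(.inr 0, .inr 1) e) : (D.crossedAt 0 ∪ D.crossedAt 1).ncard ≤ 1 := by
  have key : ∀ i, ∀ e' ∈ D.crossedAt i, e'.map .inl = e := by
    rintro i e' ⟨f, hf, hif⟩
    have hi : (.inr i : V ⊕ Fin 2) ∈ s((.inr 0 : V ⊕ Fin 2), .inr 1) := by
      fin_cases i <;> simp
    rcases hD.crosses_unique h hf (Or.inl hi) (Or.inr hif) with ⟨h1, -⟩ | ⟨h1, -⟩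
    · exact absurd (h1 ▸ hi) (inr_notMem_map_inl e' i)
    · exact h1
  have hsub : (D.crossedAt 0 ∪ D.crossedAt 1).Subsingleton := by
    intro e₁ h₁ e₂ h₂
    refine Sym2.map.injective Sum.inl_injective (Eq.trans (b := e) ?_ (Eq.symm ?_))
    · exact h₁.elim (key 0 e₁) (key 1 e₁)
    · exact h₂.elim (key 0 e₂) (key 1 e₂)
  have := hsub.finite.to_subtype
  exact Set.ncard_le_one_iff_subsingleton.mpr hsub

/-- The cases give `|V| + 1` outright, `|V|` uncrossed plus 1 crossed edge, or `|V| - 1` uncrossed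
plus 2 crossed edges. The forest bound needs a vertex, whence the separate case of empty `V`. -/
theorem IsC0.ncard_edgeSet_le_card_add_one [Fintype V] (hD : D.IsC0) (hH : H.Adj 0 1) :
    G.edgeSet.ncard ≤ Fintype.card V + 1 := by
  by_cases h : ∃ a b, D.Crosses s(.inr 0, .inl a) s(.inr 1, .inl b)
  · obtain ⟨a, b, h⟩ := h
    exact hD.ncard_edgeSet_le_of_apices_cross h
  push Not at h
  have h2 := hD.ncard_edgeSet_le_add
  by_cases hxy : ∃ e, D.Crosses s(.inr 0, .inr 1) e
  · obtain ⟨e, he⟩ := hxy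
    have h1 := D.ncard_uncrossedPart_le h
    have h3 := hD.ncard_crossed_le_one he
    omega
  · rcases isEmpty_or_nonempty V with hV | hV
    · have : G.edgeSet = ∅ := by
        ext e
        induction e using Sym2.ind with | _ a b => exact (hV.false a).elim
      simp [this]
    · have h1 := (isAcyclic_uncrossedPart hH (not_exists.mp hxy) h).ncard_edgeSet_add_one_le
      have h3 := hD.ncard_crossed_le_two
      omega

end OnePlanarDrawing

/-! ### Straight-line drawings -/

/-- The cross product of two vectors of the plane. -/
def cross (u w : ℝ × ℝ) : ℝ := u.1 * w.2 - u.2 * w.1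

theorem isSimpleArc_segment {p q : ℝ × ℝ} (h : p ≠ q) : IsSimpleArc (segment ℝ p q) p q := by
  refine ⟨⟨fun t => AffineMap.lineMap p q (t : ℝ), by fun_prop⟩, ?_, by simp, by simp, ?_⟩
  · exact (AffineMap.lineMap_injective ℝ h).comp Subtype.val_injective
  · rw [segment_eq_image_lineMap]
    ext x
    simp only [ContinuousMap.coe_mk, Set.mem_range, Set.mem_image]
    exact ⟨fun ⟨t, ht⟩ => ⟨t, t.2, ht⟩, fun ⟨t, ht, hx⟩ => ⟨⟨t, ht⟩, hx⟩⟩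

theorem mem_segment_iff_exists_add_smul {p q c : ℝ × ℝ} :
    c ∈ segment ℝ p q ↔ ∃ t : ℝ, 0 ≤ t ∧ t ≤ 1 ∧ c = p + t • (q - p) := by
  rw [segment_eq_image']
  constructor
  · rintro ⟨t, ⟨h0, h1⟩, rfl⟩
    exact ⟨t, h0, h1, rfl⟩
  · rintro ⟨t, h0, h1, rfl⟩
    exact ⟨t, ⟨h0, h1⟩, rfl⟩

/-- Two segments with a common end point meet nowhere else if none contains the other end of the
other. -/
theorem eq_of_mem_segment_of_mem_segment {u v w c : ℝ × ℝ} (hv : v ∉ segment ℝ u w)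
    (hw : w ∉ segment ℝ u v) (h1 : c ∈ segment ℝ u v) (h2 : c ∈ segment ℝ u w) : c = u := by
  obtain ⟨s, hs0, hs1, rfl⟩ := mem_segment_iff_exists_add_smul.mp h1
  obtain ⟨t, ht0, ht1, h⟩ := mem_segment_iff_exists_add_smul.mp h2
  replace h : s • (v - u) = t • (w - u) := add_left_cancel h
  by_contra hne
  have hs : 0 < s := lt_of_le_of_ne hs0 fun h0 => hne (by simp [← h0])
  have ht : 0 < t := lt_of_le_of_ne ht0 fun h0 => hne (by rw [h]; simp [← h0])
  rcases le_total s t with hst | hst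
  · refine hw (mem_segment_iff_exists_add_smul.mpr ⟨s / t, by positivity, (div_le_one ht).mpr hst, ?_⟩)
    have : (s / t) • (v - u) = w - u := by
      rw [div_eq_inv_mul, mul_smul, h, smul_smul, inv_mul_cancel₀ ht.ne', one_smul]
    rw [this]; abel
  · refine hv (mem_segment_iff_exists_add_smul.mpr ⟨t / s, by positivity, (div_le_one hs).mpr hst, ?_⟩)
    have : (t / s) • (w - u) = v - u := by
      rw [div_eq_inv_mul, mul_smul, ← h, smul_smul, inv_mul_cancel₀ hs.ne', one_smul]
    rw [this]; abel

/-- Affine coordinates of the plane with origin `c` and axes in the directions `u` and `w`. -/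
noncomputable def affineCoordinates (c u w : ℝ × ℝ) (h : cross u w ≠ 0) : ℝ × ℝ ≃ₜ ℝ × ℝ where
  toFun x := (cross (x - c) w / cross u w, cross u (x - c) / cross u w)
  invFun y := c + y.1 • u + y.2 • w
  left_inv x := by
    have h' : u.1 * w.2 - u.2 * w.1 ≠ 0 := h
    ext <;> simp only [cross, Prod.fst_add, Prod.snd_add, Prod.fst_sub, Prod.snd_sub,
      Prod.smul_fst, Prod.smul_snd, smul_eq_mul] <;>
      generalize hd : u.1 * w.2 - u.2 * w.1 = d at h' ⊢ <;> field_simp <;> rw [← hd] <;> ring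
  right_inv y := by
    have h' : u.1 * w.2 - u.2 * w.1 ≠ 0 := h
    ext <;> simp only [cross, Prod.fst_add, Prod.snd_add, Prod.fst_sub, Prod.snd_sub,
      Prod.smul_fst, Prod.smul_snd, smul_eq_mul] <;>
      generalize hd : u.1 * w.2 - u.2 * w.1 = d at h' ⊢ <;> field_simp <;> rw [← hd] <;> ring
  continuous_toFun := by unfold cross; fun_prop
  continuous_invFun := by fun_prop

/-- Two segments which are not parallel and meet in inner points cross each other there. -/
theorem crossAt_segment {p q r s c : ℝ × ℝ} (h : cross (q - p) (s - r) ≠ 0)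
    (h1 : c ∈ segment ℝ p q) (h2 : c ∈ segment ℝ r s) (hp : c ≠ p) (hq : c ≠ q) (hr : c ≠ r)
    (hs : c ≠ s) : CrossAt (segment ℝ p q) (segment ℝ r s) c := by
  obtain ⟨t, ht0, ht1, hct⟩ := mem_segment_iff_exists_add_smul.mp h1
  obtain ⟨t', ht0', ht1', hct'⟩ := mem_segment_iff_exists_add_smul.mp h2
  have e0 : 0 < t := lt_of_le_of_ne ht0 fun h0 => hp (by rw [hct]; simp [← h0])
  have e1 : t < 1 := lt_of_le_of_ne ht1 fun h0 => hq (by rw [hct]; simp [h0])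
  have e0' : 0 < t' := lt_of_le_of_ne ht0' fun h0 => hr (by rw [hct']; simp [← h0])
  have e1' : t' < 1 := lt_of_le_of_ne ht1' fun h0 => hs (by rw [hct']; simp [h0])
  let φ := affineCoordinates c (q - p) (s - r) h
  -- Since `c = p + t(q - p)`, the parameters of the first segment seen from `c` run from `-t` to `1
  -- - t`, and likewise for the second. In this box the segments are therefore the full coordinate
  -- axes.
  let U : Set (ℝ × ℝ) := φ ⁻¹' (Set.Ioo (-t) (1 - t) ×ˢ Set.Ioo (-t') (1 - t'))
  have hU : IsOpen U := (isOpen_Ioo.prod isOpen_Ioo).preimage φ.continuous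
  have hc : φ c = (0, 0) := by
    simp [φ, affineCoordinates, cross]
  have hφ : ∀ x, x = c + (φ x).1 • (q - p) + (φ x).2 • (s - r) := fun x =>
    (φ.symm_apply_apply x).symm
  have hφ1 : ∀ a : ℝ, φ (c + a • (q - p)) = (a, 0) := fun a => by
    have := φ.apply_symm_apply (a, 0)
    simpa [φ, affineCoordinates] using this
  have hφ2 : ∀ a : ℝ, φ (c + a • (s - r)) = (0, a) := fun a => by
    have := φ.apply_symm_apply (0, a)
    simpa [φ, affineCoordinates] using this
  refine ⟨φ.toOpenPartialHomeomorph.restrOpen U hU, ?_, hc, ?_⟩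
  · refine ⟨trivial, ?_⟩
    simp only [U, Set.mem_preimage, hc]
    exact ⟨⟨by simpa, by simpa⟩, ⟨by simpa, by simpa⟩⟩
  · rintro x ⟨-, hx⟩
    obtain ⟨⟨hx1, hx2⟩, ⟨hx3, hx4⟩⟩ : (_ ∧ _) ∧ (_ ∧ _) := hx
    change (_ ↔ (φ x).2 = 0) ∧ (_ ↔ (φ x).1 = 0)
    constructor
    · rw [mem_segment_iff_exists_add_smul]
      constructor
      · rintro ⟨τ, -, -, hτ⟩
        have : x = c + (τ - t) • (q - p) := by rw [hτ, hct]; module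
        rw [this, hφ1]
      · intro h0
        refine ⟨t + (φ x).1, by linarith, by linarith, ?_⟩
        have := hφ x
        rw [h0] at this
        calc x = _ := this
          _ = _ := by nth_rewrite 1 [hct]; module
    · rw [mem_segment_iff_exists_add_smul]
      constructor
      · rintro ⟨τ, -, -, hτ⟩
        have : x = c + (τ - t') • (s - r) := by rw [hτ, hct']; module
        rw [this, hφ2]
      · intro h0
        refine ⟨t' + (φ x).2, by linarith, by linarith, ?_⟩
        have := hφ x
        rw [h0] at this
        calc x = _ := this
          _ = _ := by nth_rewrite 1 [hct']; module

theorem eq_of_mem_segments {p q r s c c' : ℝ × ℝ} (h : cross (q - p) (s - r) ≠ 0)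
    (h1 : c ∈ segment ℝ p q) (h2 : c ∈ segment ℝ r s) (h1' : c' ∈ segment ℝ p q)
    (h2' : c' ∈ segment ℝ r s) : c = c' := by
  obtain ⟨a, -, -, ha⟩ := mem_segment_iff_exists_add_smul.mp h1
  obtain ⟨b, -, -, hb⟩ := mem_segment_iff_exists_add_smul.mp h2
  obtain ⟨a', -, -, ha'⟩ := mem_segment_iff_exists_add_smul.mp h1'
  obtain ⟨b', -, -, hb'⟩ := mem_segment_iff_exists_add_smul.mp h2'
  have e : (a - a') • (q - p) = (b - b') • (s - r) := by
    have : (p + a • (q - p)) - (p + a' • (q - p)) = (r + b • (s - r)) - (r + b' • (s - r)) := by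
      rw [← ha, ← ha', ← hb, ← hb']
    calc _ = (p + a • (q - p)) - (p + a' • (q - p)) := by module
      _ = _ := this
      _ = _ := by module
  have e1 := congrArg Prod.fst e
  have e2 := congrArg Prod.snd e
  simp only [Prod.smul_fst, Prod.smul_snd, smul_eq_mul] at e1 e2
  have : (a - a') * cross (q - p) (s - r) = 0 := by
    unfold cross
    linear_combination (s - r).2 * e1 - (s - r).1 * e2
  rcases mul_eq_zero.mp this with h0 | h0
  · rw [ha, ha', sub_eq_zero.mp h0]
  · exact absurd h0 h

namespace SimpleGraph

variable {V : Type*} (pt : V → ℝ × ℝ)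

/-- The straight segment representing an unordered pair of vertices. -/
def segmentOf : Sym2 V → Set (ℝ × ℝ) :=
  Sym2.lift ⟨fun u v => segment ℝ (pt u) (pt v), fun _ _ => segment_symm _ _ _⟩

@[simp] theorem segmentOf_mk (u v : V) : segmentOf pt s(u, v) = segment ℝ (pt u) (pt v) := rfl

/-- The unordered pair `{e, f}` consists of the pairs `{a₀, a₁}` and `{a₂, a₃}`. -/
def IsPairOf (a : Fin 4 → V) (e f : Sym2 V) : Prop :=
  (e = s(a 0, a 1) ∧ f = s(a 2, a 3)) ∨ (e = s(a 2, a 3) ∧ f = s(a 0, a 1))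

variable {pt}

theorem IsPairOf.symm {a : Fin 4 → V} {e f : Sym2 V} (h : IsPairOf a e f) : IsPairOf a f e :=
  h.elim (fun h => Or.inr h.symm) (fun h => Or.inl h.symm)

theorem IsPairOf.exists_eq {a : Fin 4 → V} {e f : Sym2 V} (h : IsPairOf a e f) {v : V}
    (hv : v ∈ e) : ∃ m, v = a m := by
  rcases h with ⟨rfl, -⟩ | ⟨rfl, -⟩ <;> rcases Sym2.mem_iff.mp hv with rfl | rfl <;>
    exact ⟨_, rfl⟩

theorem IsPairOf.unique {a : Fin 2 → Fin 4 → V} (ha : Function.Injective fun x : Fin 2 × Fin 4 => a x.1 x.2)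
    {e f f' : Sym2 V} {i j : Fin 2} (h : IsPairOf (a i) e f) (h' : IsPairOf (a j) e f') :
    i = j ∧ f = f' := by
  have hij : i = j := by
    induction e using Sym2.ind with | _ u v
    obtain ⟨m, hm⟩ := h.exists_eq (v := u) (by simp)
    obtain ⟨n, hn⟩ := h'.exists_eq (v := u) (by simp)
    exact congrArg Prod.fst (@ha (i, m) (j, n) (hm.symm.trans hn))
  subst hij
  refine ⟨rfl, ?_⟩
  have h02 : s(a i 0, a i 1) ≠ s(a i 2, a i 3) := by
    intro h
    have : a i 0 ∈ s(a i 2, a i 3) := h ▸ Sym2.mem_mk_left _ _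
    rcases Sym2.mem_iff.mp this with h | h
    · exact absurd (@ha (i, 0) (i, 2) h) (by simp)
    · exact absurd (@ha (i, 0) (i, 3) h) (by simp)
  rcases h with ⟨h1, h2⟩ | ⟨h1, h2⟩ <;> rcases h' with ⟨h1', h2'⟩ | ⟨h1', h2'⟩
  · exact h2.trans h2'.symm
  · exact absurd (h1.symm.trans h1') h02
  · exact absurd (h1'.symm.trans h1) h02
  · exact h2.trans h2'.symm

/-- A graph is of class `C₀` if it has a straight-line drawing in which only two pairs of edges
without common ends meet, the eight ends of these edges being distinct. -/
theorem isClassC0_of_straightLine {W : SimpleGraph V} (hinj : Function.Injective pt)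
    (hmem : ∀ u v w, W.Adj u v → pt w ∈ segment ℝ (pt u) (pt v) → w = u ∨ w = v)
    (a : Fin 2 → Fin 4 → V) (ha : Function.Injective fun x : Fin 2 × Fin 4 => a x.1 x.2)
    (hpar : ∀ i, cross (pt (a i 1) - pt (a i 0)) (pt (a i 3) - pt (a i 2)) ≠ 0)
    (hmeet : ∀ u v w z, W.Adj u v → W.Adj w z → u ≠ w → u ≠ z → v ≠ w → v ≠ z →
      Disjoint (segment ℝ (pt u) (pt v)) (segment ℝ (pt w) (pt z)) ∨
        ∃ i, IsPairOf (a i) s(u, v) s(w, z)) :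
    W.IsClassC0 := by
  -- Edges with a common end meet only there, as neither contains the far end of the other;
  -- independent edges are covered by `hmeet`.
  have hpair : ∀ e f : Sym2 V, e ∈ W.edgeSet → f ∈ W.edgeSet → e ≠ f → ∀ p,
      p ∈ segmentOf pt e → p ∈ segmentOf pt f → p ∉ Set.range pt → ∃ i, IsPairOf (a i) e f := by
    have hshare : ∀ u v w p, W.Adj u v → W.Adj u w → v ≠ w → p ∈ segment ℝ (pt u) (pt v) →
        p ∈ segment ℝ (pt u) (pt w) → p ∈ Set.range pt := by
      intro u v w p huv huw hvw h1 h2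
      refine ⟨u, (eq_of_mem_segment_of_mem_segment ?_ ?_ h1 h2).symm⟩
      · exact fun h => (hmem u w v huw h).elim huv.ne' hvw
      · exact fun h => (hmem u v w huv h).elim huw.ne' hvw.symm
    intro e f he hf hef p h1 h2 hp
    induction e using Sym2.ind with | _ u v
    induction f using Sym2.ind with | _ w z
    rw [mem_edgeSet] at he hf
    rw [segmentOf_mk] at h1 h2
    have h1' := h1
    have h2' := h2
    rw [segment_symm] at h1' h2'
    by_cases huw : u = w
    · subst huw
      exact absurd (hshare u v z p he hf (by rintro rfl; exact hef rfl) h1 h2) hp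
    by_cases huz : u = z
    · subst huz
      exact absurd (hshare u v w p he hf.symm (by rintro rfl; exact hef Sym2.eq_swap) h1 h2') hp
    by_cases hvw : v = w
    · subst hvw
      exact absurd (hshare v u z p he.symm hf (by rintro rfl; exact hef Sym2.eq_swap) h1' h2) hp
    by_cases hvz : v = z
    · subst hvz
      exact absurd (hshare v u w p he.symm hf.symm (by rintro rfl; exact hef rfl) h1' h2') hp
    exact (hmeet u v w z he hf huw huz hvw hvz).resolve_left
      fun h => Set.disjoint_left.mp h h1 h2
  have hends : ∀ e f i, IsPairOf (a i) e f → ∀ p, p ∈ segmentOf pt e → p ∈ segmentOf pt f →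
      p ∈ segment ℝ (pt (a i 0)) (pt (a i 1)) ∧ p ∈ segment ℝ (pt (a i 2)) (pt (a i 3)) := by
    rintro e f i (⟨rfl, rfl⟩ | ⟨rfl, rfl⟩) p h1 h2
    exacts [⟨h1, h2⟩, ⟨h2, h1⟩]
  have hpar' : ∀ i, cross (pt (a i 3) - pt (a i 2)) (pt (a i 1) - pt (a i 0)) ≠ 0 := by
    intro i h
    refine hpar i ?_
    unfold cross at h ⊢
    linear_combination -h
  let D₀ : PlaneDrawing W :=
    { point := pt
      arc := fun e => segmentOf pt e.1
      point_injective := hinj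
      isSimpleArc := fun u v h => isSimpleArc_segment (hinj.ne h.ne)
      mem_of_point_mem_arc := by
        rintro ⟨e, he⟩ v hv
        induction e using Sym2.ind with | _ u w
        exact Sym2.mem_iff.mpr (hmem u w v he hv)
      crossAt := by
        rintro ⟨e, he⟩ ⟨f, hf⟩ p hef h1 h2 hp
        obtain ⟨i, hi⟩ := hpair e f he hf (fun h => hef (Subtype.ext h)) p h1 h2 hp
        have hne : ∀ v, p ≠ pt v := fun v h => hp ⟨v, h.symm⟩
        rcases hi with ⟨rfl, rfl⟩ | ⟨rfl, rfl⟩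
        · exact crossAt_segment (hpar i) h1 h2 (hne _) (hne _) (hne _) (hne _)
        · exact crossAt_segment (hpar' i) h1 h2 (hne _) (hne _) (hne _) (hne _)
      not_adjacent_of_cross := by
        rintro ⟨e, he⟩ ⟨f, hf⟩ p hef h1 h2 hp v ⟨hv, hv'⟩
        obtain ⟨i, hi⟩ := hpair e f he hf (fun h => hef (Subtype.ext h)) p h1 h2 hp
        have key : ∀ m n : Fin 4, m ≠ n → a i m ≠ a i n := fun m n hmn h =>
          hmn (congrArg Prod.snd (@ha (i, m) (i, n) h))
        have e02 := key 0 2 (by decide)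
        have e03 := key 0 3 (by decide)
        have e12 := key 1 2 (by decide)
        have e13 := key 1 3 (by decide)
        rcases hi with ⟨rfl, rfl⟩ | ⟨rfl, rfl⟩ <;>
          rcases Sym2.mem_iff.mp hv with h | h <;> rcases Sym2.mem_iff.mp hv' with h' | h' <;>
          simp_all }
  have hcr : ∀ (e f : W.edgeSet) p, D₀.IsCrossing e f p → ∃ i, IsPairOf (a i) e.1 f.1 :=
    fun e f p h => hpair e f e.2 f.2 (fun h' => h.1 (Subtype.ext h')) p h.2.1 h.2.2.1 h.2.2.2
  have hpoint : ∀ (e f e' f' : W.edgeSet) p p' i, D₀.IsCrossing e f p → D₀.IsCrossing e' f' p' →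
      IsPairOf (a i) e.1 f.1 → IsPairOf (a i) e'.1 f'.1 → p = p' := by
    intro e f e' f' p p' i h h' hi hi'
    have h1 := hends _ _ i hi p h.2.1 h.2.2.1
    have h2 := hends _ _ i hi' p' h'.2.1 h'.2.2.1
    exact eq_of_mem_segments (hpar i) h1.1 h1.2 h2.1 h2.2
  refine ⟨⟨D₀, ?_⟩, ?_⟩
  · intro e f f' p p' h h'
    obtain ⟨i, hi⟩ := hcr _ _ _ h
    obtain ⟨j, hj⟩ := hcr _ _ _ h'
    obtain ⟨rfl, hff⟩ := hi.unique ha hj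
    exact ⟨Subtype.ext hff, hpoint _ _ _ _ _ _ _ h h' hi hj⟩
  · have hnb : ∀ (e₀ f₀ : W.edgeSet) p (_ : D₀.IsCrossing e₀ f₀ p) (e : W.edgeSet) v, v ∈ e.1 →
        p ∈ D₀.arc e → ∃ (g g' : W.edgeSet) (i : Fin 2) (m : Fin 4), D₀.IsCrossing g g' p ∧
          IsPairOf (a i) g.1 g'.1 ∧ v = a i m := by
      intro e₀ f₀ p h e v hv he
      have : ∃ g' : W.edgeSet, D₀.IsCrossing e g' p := by
        by_cases hee : e = e₀
        · exact ⟨f₀, hee ▸ h⟩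
        · exact ⟨e₀, hee, he, h.2.1, h.2.2.2⟩
      obtain ⟨g', hg'⟩ := this
      obtain ⟨i, hi⟩ := hcr _ _ _ hg'
      obtain ⟨m, hm⟩ := hi.exists_eq hv
      exact ⟨e, g', i, m, hg', hi, hm⟩
    -- All neighbours of a false vertex are ends of its crossing pair. The eight ends being
    -- distinct, a common neighbour forces the same pair, and two segments that are not parallel
    -- meet only once.
    rintro ⟨c₁, e₁, f₁, h₁⟩ ⟨c₂, e₂, f₂, h₂⟩ hne
    rw [Set.eq_empty_iff_forall_notMem]
    rintro (v | c) ⟨hv₁, hv₂⟩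
    · obtain ⟨e, hve, hce⟩ := hv₁
      obtain ⟨e', hve', hce'⟩ := hv₂
      obtain ⟨g, g', i, m, hg, hi, hm⟩ := hnb _ _ _ h₁ e v hve hce
      obtain ⟨k, k', j, n, hk, hj, hn⟩ := hnb _ _ _ h₂ e' v hve' hce'
      obtain rfl : i = j := congrArg Prod.fst (@ha (i, m) (j, n) (hm.symm.trans hn))
      exact hne (Subtype.ext (hpoint _ _ _ _ _ _ _ hg hk hi hj))
    · exact hv₁

end SimpleGraph

/-! ### An explicit drawing with lattice points -/

namespace LatticePlane

/-- The orientation determinant of three lattice points. -/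
def orient (p q r : ℤ × ℤ) : ℤ := (q.1 - p.1) * (r.2 - p.2) - (q.2 - p.2) * (r.1 - p.1)

/-- The segments `pq` and `rs` are separated by the line through one of them, or by a vertical
line. -/
def Apart (p q r s : ℤ × ℤ) : Prop :=
  (0 < orient p q r ∧ 0 < orient p q s) ∨ (orient p q r < 0 ∧ orient p q s < 0) ∨
  (0 < orient r s p ∧ 0 < orient r s q) ∨ (orient r s p < 0 ∧ orient r s q < 0) ∨
  (p.1 < r.1 ∧ p.1 < s.1 ∧ q.1 < r.1 ∧ q.1 < s.1) ∨
  (r.1 < p.1 ∧ r.1 < q.1 ∧ s.1 < p.1 ∧ s.1 < q.1)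

/-- The point `r` is off the line through `p` and `q`, or to the left or right of both points. -/
def Off (p q r : ℤ × ℤ) : Prop :=
  0 < orient p q r ∨ orient p q r < 0 ∨ (r.1 < p.1 ∧ r.1 < q.1) ∨ (p.1 < r.1 ∧ q.1 < r.1)

/-- A lattice point as a point of the plane. -/
def toReal (p : ℤ × ℤ) : ℝ × ℝ := (p.1, p.2)

theorem toReal_injective : Function.Injective toReal := by
  intro p q h
  simp only [toReal, Prod.mk.injEq, Int.cast_inj] at h
  exact Prod.ext h.1 h.2

theorem segment_subset_halfPlane {p q : ℝ × ℝ} {α β γ : ℝ} (hp : α * p.1 + β * p.2 ≤ γ)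
    (hq : α * q.1 + β * q.2 ≤ γ) {x : ℝ × ℝ} (hx : x ∈ segment ℝ p q) :
    α * x.1 + β * x.2 ≤ γ := by
  obtain ⟨a, b, ha, hb, hab, rfl⟩ := hx
  simp only [Prod.fst_add, Prod.snd_add, Prod.smul_fst, Prod.smul_snd, smul_eq_mul]
  have hb' : b = 1 - a := by linarith
  subst hb'
  nlinarith [mul_le_mul_of_nonneg_left hp ha, mul_le_mul_of_nonneg_left hq hb]

theorem disjoint_segment_of_separated {p q r s : ℤ × ℤ} {α β : ℤ}
    (h : (α * p.1 + β * p.2 < α * r.1 + β * r.2 ∧ α * p.1 + β * p.2 < α * s.1 + β * s.2) ∧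
      (α * q.1 + β * q.2 < α * r.1 + β * r.2 ∧ α * q.1 + β * q.2 < α * s.1 + β * s.2)) :
    Disjoint (segment ℝ (toReal p) (toReal q)) (segment ℝ (toReal r) (toReal s)) := by
  rw [Set.disjoint_left]
  intro x h1 h2
  let γ : ℤ := max (α * p.1 + β * p.2) (α * q.1 + β * q.2)
  let δ : ℤ := min (α * r.1 + β * r.2) (α * s.1 + β * s.2)
  have hγδ : γ < δ := by
    simp only [γ, δ, max_lt_iff, lt_min_iff]
    tauto
  have hp : α * p.1 + β * p.2 ≤ γ := le_max_left _ _
  have hq : α * q.1 + β * q.2 ≤ γ := le_max_right _ _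
  have hr : -α * r.1 + -β * r.2 ≤ -δ := by
    have : δ ≤ α * r.1 + β * r.2 := min_le_left _ _
    linarith
  have hs : -α * s.1 + -β * s.2 ≤ -δ := by
    have : δ ≤ α * s.1 + β * s.2 := min_le_right _ _
    linarith
  have h1' : (α : ℝ) * x.1 + β * x.2 ≤ γ := segment_subset_halfPlane
    (p := toReal p) (q := toReal q) (by simp only [toReal]; exact_mod_cast hp) (by simp only [toReal]; exact_mod_cast hq) h1
  have h2' : ((-α : ℤ) : ℝ) * x.1 + ((-β : ℤ) : ℝ) * x.2 ≤ ((-δ : ℤ) : ℝ) :=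
    segment_subset_halfPlane
      (p := toReal r) (q := toReal s) (by simp only [toReal]; exact_mod_cast hr) (by simp only [toReal]; exact_mod_cast hs) h2
  have h3 : (γ : ℝ) < δ := by exact_mod_cast hγδ
  push_cast at h2'
  linarith

theorem Apart.disjoint {p q r s : ℤ × ℤ} (h : Apart p q r s) :
    Disjoint (segment ℝ (toReal p) (toReal q)) (segment ℝ (toReal r) (toReal s)) := by
  unfold Apart orient at h
  rcases h with ⟨h1, h2⟩ | ⟨h1, h2⟩ | ⟨h1, h2⟩ | ⟨h1, h2⟩ | ⟨h1, h2, h3, h4⟩ | ⟨h1, h2, h3, h4⟩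
  · refine disjoint_segment_of_separated (α := -(q.2 - p.2)) (β := q.1 - p.1) ?_
    refine ⟨⟨?_, ?_⟩, ?_, ?_⟩ <;> linarith
  · refine disjoint_segment_of_separated (α := q.2 - p.2) (β := -(q.1 - p.1)) ?_
    refine ⟨⟨?_, ?_⟩, ?_, ?_⟩ <;> linarith
  · refine disjoint_segment_of_separated (α := s.2 - r.2) (β := -(s.1 - r.1)) ?_
    refine ⟨⟨?_, ?_⟩, ?_, ?_⟩ <;> linarith
  · refine disjoint_segment_of_separated (α := -(s.2 - r.2)) (β := s.1 - r.1) ?_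
    refine ⟨⟨?_, ?_⟩, ?_, ?_⟩ <;> linarith
  · refine disjoint_segment_of_separated (α := 1) (β := 0) ?_
    refine ⟨⟨?_, ?_⟩, ?_, ?_⟩ <;> linarith
  · refine disjoint_segment_of_separated (α := -1) (β := 0) ?_
    refine ⟨⟨?_, ?_⟩, ?_, ?_⟩ <;> linarith

/-- A point is treated as a degenerate segment. -/
theorem Off.notMem_segment {p q r : ℤ × ℤ} (h : Off p q r) :
    toReal r ∉ segment ℝ (toReal p) (toReal q) := by
  have key : Apart p q r r := by
    unfold Off at h
    unfold Apart
    tauto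
  exact fun hr => Set.disjoint_left.mp key.disjoint hr (left_mem_segment _ _ _)

/-- Positions of `k + 2` points: the points `-1` and `-2` are the apices, above and below a row
`1, …, k - 2`, the point `0` is up on the left and the point `k - 1` is far down on the right. -/
def position (k c : ℤ) : ℤ × ℤ :=
  -- Row points have odd abscissas, so the segment between the apices meets the row at the origin,
  -- strictly between 2 and 3. From `(-10, 4)` the segment to 2 passes above 1, and the one to `(4k,
  -- -1)` passes above the upper apex. The segment from `k - 3` to `(4k, -1)` passes just below `k -
  -- 2`.
  if c = -1 then (0, 2) else if c = -2 then (0, -2) else if c = 0 then (-10, 4)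
  else if c = k - 1 then (4 * k, -1) else (2 * c - 5, 0)

/-- The edges to be drawn: the apices are joined to each other and to all other points, which are
joined in a cycle, with the two further edges `{0, 2}` and `{k - 3, k - 1}`. -/
def IsEdge (k a b : ℤ) : Prop :=
  ((a = -1 ∨ a = -2) ∧ 0 ≤ b ∧ b ≤ k - 1) ∨ (0 ≤ a ∧ a ≤ k - 2 ∧ b = a + 1) ∨
  (a = 0 ∧ b = k - 1) ∨ (a = 0 ∧ b = 2) ∨ (a = k - 3 ∧ b = k - 1) ∨ (a = -1 ∧ b = -2)

/-- The coordinates of the point `c`. -/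
def HasPosition (k c : ℤ) (p : ℤ × ℤ) : Prop :=
  (c = -1 ∧ p = (0, 2)) ∨ (c = -2 ∧ p = (0, -2)) ∨ (c = 0 ∧ p = (-10, 4)) ∨
  (c = k - 1 ∧ p = (4 * k, -1)) ∨ (1 ≤ c ∧ c ≤ k - 2 ∧ p = (2 * c - 5, 0))

theorem hasPosition {k c : ℤ} (h0 : -2 ≤ c) (h1 : c ≤ k - 1) :
    HasPosition k c (position k c) := by
  unfold HasPosition position
  split_ifs <;> simp <;> omega

/-- The possible shapes of an edge together with the coordinates of its ends. -/
def EdgeShape (k a b : ℤ) (p q : ℤ × ℤ) : Prop :=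
  ((a = -1 ∧ p = (0, 2) ∨ a = -2 ∧ p = (0, -2)) ∧ (b = 0 ∧ q = (-10, 4) ∨
    b = k - 1 ∧ q = (4 * k, -1) ∨ 1 ≤ b ∧ b ≤ k - 2 ∧ q = (2 * b - 5, 0))) ∨
  (a = 0 ∧ p = (-10, 4) ∧ (b = 1 ∧ q = (-3, 0) ∨ b = 2 ∧ q = (-1, 0) ∨
    b = k - 1 ∧ q = (4 * k, -1))) ∨
  (b = k - 1 ∧ q = (4 * k, -1) ∧ (a = k - 3 ∧ p = (2 * k - 11, 0) ∨
    a = k - 2 ∧ p = (2 * k - 9, 0))) ∨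
  (1 ≤ a ∧ a ≤ k - 3 ∧ b = a + 1 ∧ p = (2 * a - 5, 0) ∧ q = (2 * a - 3, 0)) ∨
  (a = -1 ∧ b = -2 ∧ p = (0, 2) ∧ q = (0, -2))

theorem IsEdge.shape {k a b : ℤ} (hk : 6 ≤ k) (h : IsEdge k a b) :
    EdgeShape k a b (position k a) (position k b) := by
  have ha : HasPosition k a (position k a) := hasPosition (by unfold IsEdge at h; omega)
    (by unfold IsEdge at h; omega)
  have hb : HasPosition k b (position k b) := hasPosition (by unfold IsEdge at h; omega)
    (by unfold IsEdge at h; omega)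
  generalize position k a = p at ha ⊢
  generalize position k b = q at hb ⊢
  obtain ⟨p1, p2⟩ := p
  obtain ⟨q1, q2⟩ := q
  unfold IsEdge at h
  unfold HasPosition at ha hb
  unfold EdgeShape
  simp only [Prod.mk.injEq] at ha hb ⊢
  rcases h with ⟨h, h'⟩ | h | h | h | h | h
  · left; omega
  · by_cases h1 : a = 0
    · right; left; omega
    · by_cases h2 : a = k - 2
      · right; right; left; omega
      · right; right; right; left; omega
  · right; left; omega
  · right; left; omega
  · right; right; left; omega
  · right; right; right; right; omega

theorem off_of_isEdge {k a b c : ℤ} (hk : 6 ≤ k) (h : IsEdge k a b) (h0 : -2 ≤ c) (h1 : c ≤ k - 1)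
    (hca : c ≠ a) (hcb : c ≠ b) : Off (position k a) (position k b) (position k c) := by
  have hs := h.shape hk
  have hc := hasPosition h0 h1
  clear h
  generalize position k a = p at hs ⊢
  generalize position k b = q at hs ⊢
  generalize position k c = r at hc ⊢
  rcases hs with ⟨⟨rfl, rfl⟩ | ⟨rfl, rfl⟩, ⟨rfl, rfl⟩ | ⟨rfl, rfl⟩ | ⟨hb, hb', rfl⟩⟩ |
    ⟨rfl, rfl, ⟨rfl, rfl⟩ | ⟨rfl, rfl⟩ | ⟨rfl, rfl⟩⟩ |
    ⟨rfl, rfl, ⟨rfl, rfl⟩ | ⟨rfl, rfl⟩⟩ | ⟨ha, ha', rfl, rfl, rfl⟩ | ⟨rfl, rfl, rfl, rfl⟩ <;>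
  rcases hc with ⟨rfl, rfl⟩ | ⟨rfl, rfl⟩ | ⟨rfl, rfl⟩ | ⟨rfl, rfl⟩ | ⟨hc, hc', rfl⟩ <;>
  simp only [Off, orient] <;> omega

/-- The pairs of edges which meet in the straight-line drawing. -/
def Meet (k a b c d : ℤ) : Prop :=
  (a = -1 ∧ b = 1 ∧ c = 0 ∧ d = 2) ∨ (a = -2 ∧ b = k - 2 ∧ c = k - 3 ∧ d = k - 1) ∨
  (a = -1 ∧ b = -2 ∧ c = 2 ∧ d = 3)

set_option maxHeartbeats 4000000 in
theorem apart_or_meet {k a b c d : ℤ} (hk : 6 ≤ k) (h : IsEdge k a b) (h' : IsEdge k c d)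
    (hac : a ≠ c) (had : a ≠ d) (hbc : b ≠ c) (hbd : b ≠ d) :
    Apart (position k a) (position k b) (position k c) (position k d) ∨
      Meet k a b c d ∨ Meet k c d a b := by
  -- All ordinates in an edge shape are numerals, so every orientation determinant is linear in `k`
  -- and the labels.
  have hs := h.shape hk
  have hs' := h'.shape hk
  clear h h'
  have hac' := lt_or_gt_of_ne hac
  have had' := lt_or_gt_of_ne had
  have hbc' := lt_or_gt_of_ne hbc
  have hbd' := lt_or_gt_of_ne hbd
  -- Comparison with 2 tells on which side of the line through the apices a row point lies.
  have ha2 := lt_trichotomy a 2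
  have hc2 := lt_trichotomy c 2
  have hb2 := le_or_gt b 2
  have hd2 := le_or_gt d 2
  generalize position k a = p at hs ⊢
  generalize position k b = q at hs ⊢
  generalize position k c = r at hs' ⊢
  generalize position k d = s at hs' ⊢
  rcases hs with ⟨⟨rfl, rfl⟩ | ⟨rfl, rfl⟩, ⟨rfl, rfl⟩ | ⟨rfl, rfl⟩ | ⟨hb, hb', rfl⟩⟩ |
    ⟨rfl, rfl, ⟨rfl, rfl⟩ | ⟨rfl, rfl⟩ | ⟨rfl, rfl⟩⟩ |
    ⟨rfl, rfl, ⟨rfl, rfl⟩ | ⟨rfl, rfl⟩⟩ | ⟨ha, ha', rfl, rfl, rfl⟩ | ⟨rfl, rfl, rfl, rfl⟩ <;>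
  rcases hs' with ⟨⟨rfl, rfl⟩ | ⟨rfl, rfl⟩, ⟨rfl, rfl⟩ | ⟨rfl, rfl⟩ | ⟨hd, hd', rfl⟩⟩ |
    ⟨rfl, rfl, ⟨rfl, rfl⟩ | ⟨rfl, rfl⟩ | ⟨rfl, rfl⟩⟩ |
    ⟨rfl, rfl, ⟨rfl, rfl⟩ | ⟨rfl, rfl⟩⟩ | ⟨hc, hc', rfl, rfl, rfl⟩ | ⟨rfl, rfl, rfl, rfl⟩ <;>
  first
  | (exfalso; omega)
  | exact Or.inl (Or.inl (by simp only [orient]; omega))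
  | exact Or.inl (Or.inr (Or.inl (by simp only [orient]; omega)))
  | exact Or.inl (Or.inr (Or.inr (Or.inl (by simp only [orient]; omega))))
  | exact Or.inl (Or.inr (Or.inr (Or.inr (Or.inl (by simp only [orient]; omega)))))
  | skip
  all_goals
    rcases hac' with h1 | h1 <;> rcases had' with h2 | h2 <;> (try (exfalso; omega)) <;>
    rcases hbc' with h3 | h3 <;> (try (exfalso; omega)) <;>
    rcases hbd' with h4 | h4 <;> (try (exfalso; omega)) <;>
    rcases ha2 with h5 | h5 | h5 <;> rcases hc2 with h6 | h6 | h6 <;> (try (exfalso; omega)) <;>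
    rcases hb2 with h7 | h7 <;> rcases hd2 with h8 | h8 <;>
    first
    | (exfalso; omega)
    | exact Or.inl (Or.inl (by simp only [orient]; omega))
    | exact Or.inl (Or.inr (Or.inl (by simp only [orient]; omega)))
    | exact Or.inl (Or.inr (Or.inr (Or.inl (by simp only [orient]; omega))))
    | exact Or.inl (Or.inr (Or.inr (Or.inr (Or.inl (by simp only [orient]; omega)))))
    | exact Or.inl (Or.inr (Or.inr (Or.inr (Or.inr (by dsimp only; omega)))))
    | exact Or.inr (Or.inl (Or.inl ⟨by omega, by omega, by omega, by omega⟩))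
    | exact Or.inr (Or.inl (Or.inr (Or.inl ⟨by omega, by omega, by omega, by omega⟩)))
    | exact Or.inr (Or.inl (Or.inr (Or.inr ⟨by omega, by omega, by omega, by omega⟩)))
    | exact Or.inr (Or.inr (Or.inl ⟨by omega, by omega, by omega, by omega⟩))
    | exact Or.inr (Or.inr (Or.inr (Or.inl ⟨by omega, by omega, by omega, by omega⟩)))
    | exact Or.inr (Or.inr (Or.inr (Or.inr ⟨by omega, by omega, by omega, by omega⟩)))

end LatticePlane

namespace LatticePlane

theorem position_injOn {k c d : ℤ} (hc0 : -2 ≤ c) (hc1 : c ≤ k - 1) (hd0 : -2 ≤ d)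
    (hd1 : d ≤ k - 1) (h : position k c = position k d) : c = d := by
  have h1 := hasPosition hc0 hc1
  have h2 := hasPosition hd0 hd1
  rw [← h] at h2
  generalize position k c = p at h1 h2
  obtain ⟨x, y⟩ := p
  simp only [HasPosition, Prod.mk.injEq] at h1 h2
  omega

/-- The label of a vertex of a join of a graph on `Fin k` with a graph on `Fin 2`. -/
def label {k : ℕ} : Fin k ⊕ Fin 2 → ℤ
  | .inl i => i
  | .inr j => -1 - j

theorem label_bounds {k : ℕ} (hk : 6 ≤ k) (v : Fin k ⊕ Fin 2) :
    -2 ≤ label v ∧ label v ≤ k - 1 := by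
  rcases v with i | j <;> simp only [label] <;> omega

theorem label_injective {k : ℕ} : Function.Injective (label (k := k)) := by
  rintro (i | i) (j | j) h <;> simp only [label] at h
  · exact congrArg _ (Fin.ext (by omega))
  · omega
  · omega
  · exact congrArg _ (Fin.ext (by omega))

/-- The crossing pairs of edges. -/
def crossingEnds {k : ℕ} (hk : 6 ≤ k) : Fin 2 → Fin 4 → Fin k ⊕ Fin 2 :=
  ![![.inr 0, .inl ⟨1, by omega⟩, .inl ⟨0, by omega⟩, .inl ⟨2, by omega⟩],
    ![.inr 1, .inl ⟨k - 2, by omega⟩, .inl ⟨k - 3, by omega⟩, .inl ⟨k - 1, by omega⟩]]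

/-- This is where `k ≥ 6` matters: it keeps `{0, 1, 2}` and `{k-3, k-2, k-1}` disjoint. -/
theorem crossingEnds_injective {k : ℕ} (hk : 6 ≤ k) :
    Function.Injective fun x : Fin 2 × Fin 4 => crossingEnds hk x.1 x.2 := by
  rintro ⟨i, m⟩ ⟨j, n⟩ h
  fin_cases i <;> fin_cases m <;> fin_cases j <;> fin_cases n <;>
    simp [crossingEnds] at h ⊢ <;> omega

/-- The position of a vertex in the plane. -/
noncomputable def point {k : ℕ} (v : Fin k ⊕ Fin 2) : ℝ × ℝ := toReal (position k (label v))

open SimpleGraph in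
/-- Joins of suitable subgraphs of the drawn graph with graphs on two vertices are of class `C₀`. -/
theorem isClassC0_joinProduct {k : ℕ} (hk : 6 ≤ k) {G : SimpleGraph (Fin k)}
    {H : SimpleGraph (Fin 2)}
    (hG : ∀ i j, G.Adj i j → IsEdge k i j ∨ IsEdge k j i)
    (hGH : H.Adj 0 1 → ¬ G.Adj ⟨2, by omega⟩ ⟨3, by omega⟩) :
    (G.joinProduct H).IsClassC0 := by
  have hk' : (6 : ℤ) ≤ k := by exact_mod_cast hk
  have hedge : ∀ u v, (G.joinProduct H).Adj u v →
      IsEdge k (label u) (label v) ∨ IsEdge k (label v) (label u) := by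
    rintro (i | i) (j | j) h
    · exact hG i j (by simpa using h)
    · right; left; simp only [label]; omega
    · left; left; simp only [label]; omega
    · have := h.ne
      have hij : i ≠ j := fun h' => this (congrArg _ h')
      simp only [label, IsEdge]
      omega
  have hne : ∀ {u v : Fin k ⊕ Fin 2}, u ≠ v → label u ≠ label v := fun h h' => h (label_injective h')
  have hpair : ∀ u v w z, (G.joinProduct H).Adj u v → (G.joinProduct H).Adj w z →
      Meet k (label u) (label v) (label w) (label z) →
      ∃ i, IsPairOf (crossingEnds hk i) s(u, v) s(w, z) := by
    have hl : ∀ {u v : Fin k ⊕ Fin 2}, label u = label v → u = v := fun h => label_injective h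
    rintro u v w z huv hwz (⟨hu, hv, hw, hz⟩ | ⟨hu, hv, hw, hz⟩ | ⟨hu, hv, hw, hz⟩)
    · obtain rfl : u = crossingEnds hk 0 0 := hl (by rw [hu]; rfl)
      obtain rfl : v = crossingEnds hk 0 1 := hl (by rw [hv]; rfl)
      obtain rfl : w = crossingEnds hk 0 2 := hl (by rw [hw]; rfl)
      obtain rfl : z = crossingEnds hk 0 3 := hl (by rw [hz]; rfl)
      exact ⟨0, Or.inl ⟨rfl, rfl⟩⟩
    · obtain rfl : u = crossingEnds hk 1 0 := hl (by rw [hu]; rfl)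
      obtain rfl : v = crossingEnds hk 1 1 := hl (by rw [hv]; simp [crossingEnds, label]; omega)
      obtain rfl : w = crossingEnds hk 1 2 := hl (by rw [hw]; simp [crossingEnds, label]; omega)
      obtain rfl : z = crossingEnds hk 1 3 := hl (by rw [hz]; simp [crossingEnds, label]; omega)
      exact ⟨1, Or.inl ⟨rfl, rfl⟩⟩
    · obtain rfl : u = .inr 0 := hl (by rw [hu]; rfl)
      obtain rfl : v = .inr 1 := hl (by rw [hv]; rfl)
      have h2 : 2 < k := by omega
      have h3 : 3 < k := by omega
      obtain rfl : w = .inl ⟨2, h2⟩ := hl (by rw [hw]; rfl)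
      obtain rfl : z = .inl ⟨3, h3⟩ := hl (by rw [hz]; rfl)
      -- The third meeting pair consists of the edge between the apices and {2, 3}, which `hGH`
      -- excludes from being present together.
      exact absurd (by simpa using hwz) (hGH (by simpa using huv))
  have hmeet : ∀ u v w z, (G.joinProduct H).Adj u v → (G.joinProduct H).Adj w z →
      IsEdge k (label u) (label v) → IsEdge k (label w) (label z) →
      u ≠ w → u ≠ z → v ≠ w → v ≠ z →
      Disjoint (segment ℝ (point u) (point v)) (segment ℝ (point w) (point z)) ∨
        ∃ i, IsPairOf (crossingEnds hk i) s(u, v) s(w, z) := by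
    intro u v w z huv hwz h h' huw huz hvw hvz
    rcases apart_or_meet hk' h h' (hne huw) (hne huz) (hne hvw) (hne hvz) with h1 | h1 | h1
    · exact Or.inl h1.disjoint
    · exact Or.inr (hpair u v w z huv hwz h1)
    · obtain ⟨i, hi⟩ := hpair w z u v hwz huv h1
      exact Or.inr ⟨i, hi.symm⟩
  refine isClassC0_of_straightLine (pt := point) ?_ ?_ (crossingEnds hk)
    (crossingEnds_injective hk) ?_ ?_
  · intro u v h
    have hu := label_bounds hk u
    have hv := label_bounds hk v
    exact label_injective (position_injOn hu.1 hu.2 hv.1 hv.2 (toReal_injective h))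
  · intro u v w huv hw
    by_contra! hcon
    have hb := label_bounds hk w
    rcases hedge u v huv with h | h
    · exact (off_of_isEdge hk' h hb.1 hb.2 (hne hcon.1) (hne hcon.2)).notMem_segment hw
    · rw [segment_symm] at hw
      exact (off_of_isEdge hk' h hb.1 hb.2 (hne hcon.2) (hne hcon.1)).notMem_segment hw
  · have p0 : position k 0 = (-10, 4) := by simp [position]
    have p1 : position k 1 = (-3, 0) := by
      rw [position, if_neg (by omega), if_neg (by omega), if_neg (by omega), if_neg (by omega)]
      norm_num
    have p2 : position k 2 = (-1, 0) := by
      rw [position, if_neg (by omega), if_neg (by omega), if_neg (by omega), if_neg (by omega)]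
      norm_num
    have q1 : position k ((k - 1 : ℕ) : ℤ) = (4 * (k : ℤ), -1) := by
      rw [position, if_neg (by omega), if_neg (by omega), if_neg (by omega), if_pos (by omega)]
    have q2 : position k ((k - 2 : ℕ) : ℤ) = (2 * (k : ℤ) - 9, 0) := by
      rw [position, if_neg (by omega), if_neg (by omega), if_neg (by omega), if_neg (by omega)]
      exact Prod.ext (by dsimp only; omega) rfl
    have q3 : position k ((k - 3 : ℕ) : ℤ) = (2 * (k : ℤ) - 11, 0) := by
      rw [position, if_neg (by omega), if_neg (by omega), if_neg (by omega), if_neg (by omega)]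
      exact Prod.ext (by dsimp only; omega) rfl
    have hkR : (6 : ℝ) ≤ k := by exact_mod_cast hk
    intro i
    fin_cases i
    · have : point (k := k) (.inr 0) = (0, 2) := by simp [point, label, position, toReal]
      simp [crossingEnds, this]
      simp [point, label, p0, p1, p2, toReal, cross]
      norm_num
    · have : point (k := k) (.inr 1) = (0, -2) := by simp [point, label, position, toReal]
      simp [crossingEnds, this]
      simp only [point, label, q1, q2, q3, toReal, cross]
      push_cast
      intro h
      simp at h
      nlinarith
  · intro u v w z huv hwz huw huz hvw hvz
    rcases hedge u v huv with h | h <;> rcases hedge w z hwz with h' | h'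
    · exact hmeet u v w z huv hwz h h' huw huz hvw hvz
    · rw [segment_symm ℝ (point w), Sym2.eq_swap (a := w)]
      exact hmeet u v z w huv hwz.symm h h' huz huw hvz hvw
    · rw [segment_symm ℝ (point u), Sym2.eq_swap (a := u)]
      exact hmeet v u w z huv.symm hwz h h' hvw hvz huw huz
    · rw [segment_symm ℝ (point u), Sym2.eq_swap (a := u), segment_symm ℝ (point w),
        Sym2.eq_swap (a := w)]
      exact hmeet v u z w huv.symm hwz.symm h h' hvz hvw huz huw

/-! ### The extremal graphs -/

/-- The smaller end of the edge number `n`. -/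
def lowerEnd (k n : ℕ) : ℕ := if n < k - 1 then n else if n = k + 1 then k - 3 else 0

/-- The larger end of the edge number `n`. -/
def upperEnd (k n : ℕ) : ℕ := if n < k - 1 then n + 1 else if n = k then 2 else k - 1

theorem ends_lt {k n : ℕ} (hk : 6 ≤ k) : lowerEnd k n < upperEnd k n ∧ upperEnd k n < k := by
  unfold lowerEnd upperEnd
  split_ifs <;> omega

/-- The edges of a cycle on `Fin k` with two chords, numbered from `0` to `k + 1`. -/
def numberedEdge {k : ℕ} (hk : 6 ≤ k) (n : ℕ) : Sym2 (Fin k) :=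
  -- For `n < k - 1` this is {n, n+1}; the numbers `k - 1`, `k`, `k + 1` stand for {0, k-1}, {0, 2}
  -- and {k-3, k-1}.
  s(⟨lowerEnd k n, (ends_lt hk).1.trans (ends_lt hk).2⟩, ⟨upperEnd k n, (ends_lt hk).2⟩)

theorem numberedEdge_injOn {k : ℕ} (hk : 6 ≤ k) :
    Set.InjOn (numberedEdge hk) (Finset.range (k + 2)) := by
  intro m hm n hn h
  simp only [Finset.coe_range, Set.mem_Iio] at hm hn
  have h1 := ends_lt (n := m) hk
  have h2 := ends_lt (n := n) hk
  simp only [numberedEdge, Sym2.eq_iff, Fin.mk.injEq] at h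
  replace h : lowerEnd k m = lowerEnd k n ∧ upperEnd k m = upperEnd k n := by omega
  unfold lowerEnd upperEnd at h
  split_ifs at h <;> omega

/-- The graph with the edges whose numbers lie in `S`. -/
def numberedGraph {k : ℕ} (hk : 6 ≤ k) (S : Finset ℕ) : SimpleGraph (Fin k) :=
  SimpleGraph.fromEdgeSet (numberedEdge hk '' S)

theorem ncard_edgeSet_numberedGraph {k : ℕ} (hk : 6 ≤ k) {S : Finset ℕ}
    (hS : S ⊆ Finset.range (k + 2)) : (numberedGraph hk S).edgeSet.ncard = S.card := by
  have hdiag : numberedEdge hk '' S \ Sym2.diagSet = numberedEdge hk '' S := by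
    rw [sdiff_eq_left, Set.disjoint_left]
    rintro _ ⟨n, -, rfl⟩ h
    have := ends_lt (n := n) hk
    simp [numberedEdge] at h
    omega
  rw [numberedGraph, SimpleGraph.edgeSet_fromEdgeSet, hdiag,
    ((numberedEdge_injOn hk).mono (by exact_mod_cast hS)).ncard_image, Set.ncard_coe_finset]

theorem exists_of_numberedGraph_adj {k : ℕ} {hk : 6 ≤ k} {S : Finset ℕ} {i j : Fin k}
    (h : (numberedGraph hk S).Adj i j) : ∃ n ∈ S,
      (i.val = lowerEnd k n ∧ j.val = upperEnd k n) ∨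
      (j.val = lowerEnd k n ∧ i.val = upperEnd k n) := by
  obtain ⟨⟨n, hn, h⟩, -⟩ := (SimpleGraph.fromEdgeSet_adj _).mp h
  refine ⟨n, hn, ?_⟩
  simp only [numberedEdge, Sym2.eq_iff, Fin.ext_iff] at h
  omega

theorem isEdge_ends {k n : ℕ} (hk : 6 ≤ k) : IsEdge k (lowerEnd k n) (upperEnd k n) := by
  unfold lowerEnd upperEnd IsEdge
  split_ifs <;> first
    | (exfalso; omega)
    | exact Or.inr (Or.inl ⟨by omega, by omega, by omega⟩)
    | exact Or.inr (Or.inr (Or.inl ⟨by omega, by omega⟩))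
    | exact Or.inr (Or.inr (Or.inr (Or.inl ⟨by omega, by omega⟩)))
    | exact Or.inr (Or.inr (Or.inr (Or.inr (Or.inl ⟨by omega, by omega⟩))))

theorem isClassC0_numberedGraph {k : ℕ} (hk : 6 ≤ k) {S : Finset ℕ}
    {H : SimpleGraph (Fin 2)} (hSH : H.Adj 0 1 → 2 ∉ S) :
    ((numberedGraph hk S).joinProduct H).IsClassC0 := by
  refine isClassC0_joinProduct hk (fun i j h => ?_) fun hH h => ?_
  · obtain ⟨n, -, ⟨hi, hj⟩ | ⟨hj, hi⟩⟩ := exists_of_numberedGraph_adj h <;> rw [hi, hj]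
    · exact Or.inl (isEdge_ends hk)
    · exact Or.inr (isEdge_ends hk)
  · obtain ⟨n, hn, h⟩ := exists_of_numberedGraph_adj h
    have : n ≠ 2 := by rintro rfl; exact hSH hH hn
    unfold lowerEnd upperEnd at h
    rcases h with ⟨h1, h2⟩ | ⟨h1, h2⟩ <;> dsimp only at h1 h2 <;> split_ifs at h1 h2 <;> omega

end LatticePlane

theorem mainTheorem7 :
    ((∀ (V : Type*) [Fintype V] (G : SimpleGraph V),
        (G.joinProduct (⊥ : SimpleGraph (Fin 2))).IsClassC0 →
          G.edgeSet.ncard ≤ Fintype.card V + 2) ∧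
      (∀ k : ℕ, 6 ≤ k → ∃ G : SimpleGraph (Fin k),
        (G.joinProduct (⊥ : SimpleGraph (Fin 2))).IsClassC0 ∧ G.edgeSet.ncard = k + 2)) ∧
    ((∀ (V : Type*) [Fintype V] (G : SimpleGraph V),
        (G.joinProduct (SimpleGraph.pathGraph 2)).IsClassC0 →
          G.edgeSet.ncard ≤ Fintype.card V + 1) ∧
      (∀ k : ℕ, 6 ≤ k → ∃ G : SimpleGraph (Fin k),
        (G.joinProduct (SimpleGraph.pathGraph 2)).IsClassC0 ∧ G.edgeSet.ncard = k + 1)) := by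
  refine ⟨⟨fun V _ G ⟨D, hD⟩ => hD.ncard_edgeSet_le_card_add_two, fun k hk => ?_⟩,
    fun V _ G ⟨D, hD⟩ => hD.ncard_edgeSet_le_card_add_one ?_, fun k hk => ?_⟩
  · refine ⟨LatticePlane.numberedGraph hk (Finset.range (k + 2)),
      LatticePlane.isClassC0_numberedGraph hk fun h => h.elim, ?_⟩
    rw [LatticePlane.ncard_edgeSet_numberedGraph hk (Finset.Subset.refl _), Finset.card_range]
  · simp [SimpleGraph.pathGraph_adj]
  -- Edge number 2 is {2, 3}, the one that the segment between the apices would cross.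
  · refine ⟨LatticePlane.numberedGraph hk ((Finset.range (k + 2)).erase 2),
      LatticePlane.isClassC0_numberedGraph hk fun _ => Finset.notMem_erase 2 _, ?_⟩
    rw [LatticePlane.ncard_edgeSet_numberedGraph hk (Finset.erase_subset _ _),
      Finset.card_erase_of_mem (Finset.mem_range.mpr (by omega)), Finset.card_range]
    rfl
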